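/- Let $H$ be a separable complex Hilbert space and let $(H,A,\gamma)$ be a Dirac system: $A$ is a self-adjoint operator in $H$ whose domain, with the graph norm, embeds compactly into $H$ (so $A$ has discrete spectrum), and $\gamma$ is a bounded operator on $H$ with $-\gamma=\gamma^*=\gamma^{-1}$ which preserves the domain of $A$ and satisfies $A\gamma+\gamma A=0$ there. For $s\in\mathbb R$ let $H^s$ be the Sobolev space of $A$, that is, the domain of $|A|^s$ for $s\ge 0$ and, for $s<0$, the completion of $\bigcap_{t\ge0}H^t$ with respect to $\|x\|_s=\|(I+A^2)^{s/2}x\|$. For $J\subset\mathbb R$ let $Q_J$ be the spectral projection of $A$ and $H^s_J=Q_JH^s$; write $H_0=\ker A$ and $H_<=H_{(-\infty,0)}$. Let \[ \check H=H^{1/2}_{(-\infty,0]}\oplus H^{-1/2}_{(0,\infty)}, \] with the topology of the direct sum, and let $\omega$ be the form $\omega(x,y)=\langle x,\gamma y\rangle$ on $H^{1/2}$, extended to $\check H\times\check H$ by the duality pairing of $H^{1/2}$ and $H^{-1/2}$. A boundary condition is a closed linear subspace $B\subset\check H$; $B^a=\{y\in\check H:\omega(x,y)=0\text{ for all }x\in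 B\}$ is its annihilator. $B$ is regular if $B\subset H^{1/2}$, elliptic if $B$ and $B^a$ are regular, and self-adjoint if $B=B^a$. The space $(H_0,\omega)$ is called Hermitian symplectic if the $\pm1$-eigenspaces of $i\gamma$ on $H_0$ have equal dimension ($H_0=0$ is allowed), and a subspace $L\subset H_0$ is called Lagrangian if $L\perp\gamma L$ and $L\oplus\gamma L=H_0$. Let $H^\pm=\{x\in H: i\gamma x=\pm x\}$ and let $A^+:H^+\to H^-$ be the restriction of $A$ to $H^+$, with domain $H^+\cap\operatorname{dom}A$. Theorem. (1) Regular self-adjoint boundary conditions exist if and only if $(H_0,\omega)$ is Hermitian symplectic. (2) $A^+$ is a (possibly unbounded) Fredholm operator, and $(H_0,\omega)$ is Hermitian symplectic if and only if $\operatorname{ind}A^+=0$. Hence $\check H$ contains elliptic self-adjoint boundary conditions if and only if $\operatorname{ind}A^+=0$. (3) The regular self-adjoint boundary conditions are precisely the subspaces \[ B=\gamma F\oplus\{w+\gamma gw: w\in(V\oplus L)\cap H^{1/2}\}, \] where $L\subset H_0$ is a Lagrangian subspace, $H_<=F\oplus V$ is an orthogonal decomposition with $F\subset H^{1/2}$ of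 finite dimension, and $g:V\oplus L\to V\oplus L$ is a bounded operator with $g^*=g$ which maps $(V\oplus L)\cap H^{1/2}$ into $H^{1/2}$ (that is, $g$ is $1/2$-smooth). -/

import Mathlib

open scoped InnerProductSpace Topology

noncomputable section

/-- A Dirac system `(H, A, γ)`: `A` is a self-adjoint operator in the complex Hilbert space `H` whose
domain embeds compactly into `H` for the graph norm (the topology of the graph of `A`), and `γ` is
a bounded operator with `-γ = γ* = γ⁻¹` which preserves the domain of `A` and satisfies
`A γ + γ A = 0` there. -/
structure DiracSystem (H : Type*) [NormedAddCommGroup H] [InnerProductSpace ℂ H]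
    [CompleteSpace H] where
  A : H →ₗ.[ℂ] H
  selfAdjoint : IsSelfAdjoint A
  discrete : IsCompactOperator (fun p : A.graph => (p : H × H).1)
  γ : H →L[ℂ] H
  adjoint_γ : ContinuousLinearMap.adjoint γ = -γ
  γ_γ : ∀ x : H, γ (γ x) = -x
  anticomm : ∀ x : A.domain, ∃ h : γ (x : H) ∈ A.domain, A ⟨γ (x : H), h⟩ = -γ (A x)

/-- A (possibly unbounded) linear operator between normed spaces is Fredholm if it is closed and
densely defined, its kernel is finite-dimensional, and its image is closed of finite
codimension. -/
structure UnboundedFredholm {E F : Type*} [NormedAddCommGroup E] [NormedSpace ℂ E]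
    [NormedAddCommGroup F] [NormedSpace ℂ F] (T : E →ₗ.[ℂ] F) : Prop where
  closed : T.IsClosed
  dense : Dense (T.domain : Set E)
  finite_ker : FiniteDimensional ℂ (LinearMap.ker T.toFun)
  closed_range : IsClosed (LinearMap.range T.toFun : Set F)
  finite_coker : FiniteDimensional ℂ (F ⧸ LinearMap.range T.toFun)

/-- The index `dim ker T - dim coker T`. -/
def unboundedIndex {E F : Type*} [NormedAddCommGroup E] [NormedSpace ℂ E]
    [NormedAddCommGroup F] [NormedSpace ℂ F] (T : E →ₗ.[ℂ] F) : ℤ :=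
  (Module.finrank ℂ (LinearMap.ker T.toFun) : ℤ) -
    (Module.finrank ℂ (F ⧸ LinearMap.range T.toFun) : ℤ)

namespace DiracSystem

variable {H : Type*} [NormedAddCommGroup H] [InnerProductSpace ℂ H] [CompleteSpace H]

/-- The eigenspace `ker (A - l)`: all `x` in the domain of `A` with `A x = l x`. -/
def eig (D : DiracSystem H) (l : ℝ) : Submodule ℂ H :=
  D.A.graph.comap (LinearMap.prod LinearMap.id ((l : ℂ) • LinearMap.id))

theorem mem_eig (D : DiracSystem H) (l : ℝ) (x : H) :
    x ∈ D.eig l ↔ ∃ h : x ∈ D.A.domain, D.A ⟨x, h⟩ = (l : ℂ) • x := by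
  simp only [eig, Submodule.mem_comap, LinearMap.prod_apply, LinearPMap.mem_graph_iff]
  constructor
  · rintro ⟨y, rfl, h⟩
    exact ⟨y.2, h⟩
  · rintro ⟨h, h'⟩
    exact ⟨⟨x, h⟩, rfl, h'⟩

theorem isClosed_eig (D : DiracSystem H) (l : ℝ) : IsClosed (D.eig l : Set H) := by
  have hA : IsClosed (D.A.graph : Set (H × H)) := D.selfAdjoint.isClosed
  have hc : Continuous (fun x : H => (x, (l : ℂ) • x)) := by fun_prop
  exact hA.preimage hc

instance instCompleteEig (D : DiracSystem H) (l : ℝ) : CompleteSpace (D.eig l) :=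
  (D.isClosed_eig l).completeSpace_coe

theorem γ_mem_eig (D : DiracSystem H) (l : ℝ) (x : H) (hx : x ∈ D.eig (-l)) :
    D.γ x ∈ D.eig l := by
  rw [mem_eig] at hx ⊢
  obtain ⟨h, hx⟩ := hx
  obtain ⟨h', e⟩ := D.anticomm ⟨x, h⟩
  refine ⟨h', e.trans ?_⟩
  rw [hx]
  simp

theorem norm_γ (D : DiracSystem H) (x : H) : ‖D.γ x‖ = ‖x‖ := by
  have h : inner ℂ (D.γ x) (D.γ x) = inner ℂ x x := by
    rw [← ContinuousLinearMap.adjoint_inner_left, D.adjoint_γ]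
    simp [D.γ_γ]
  rw [@norm_eq_sqrt_re_inner ℂ, @norm_eq_sqrt_re_inner ℂ _ _ _ _ x, h]

/-- Formal sums `∑ x_l` of eigenvectors, `x_l ∈ ker (A - l)`. Since `A` is discrete, `H` is the
Hilbert sum of the eigenspaces, and all Sobolev spaces of `A` are spaces of such formal sums. -/
abbrev Formal (D : DiracSystem H) : Type _ := ∀ l : ℝ, D.eig l

/-- The eigenvalue `(1 + l²)^(s/2)` of `(I + A²)^(s/2)`, as a complex number. -/
def weight (s l : ℝ) : ℂ := (((1 + l ^ 2) ^ (s / 2) : ℝ) : ℂ)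

/-- The Sobolev space `H^s` of `A`, for any real `s`: the formal sums `x` for which
`∑ (1 + l²)^s ‖x_l‖²` is finite. For `s ≥ 0` it is the domain of `|A|^s`, for `s < 0` the
completion of `⋂ H^t` for the norm `‖(I + A²)^(s/2) x‖`. -/
def sobolev (D : DiracSystem H) (s : ℝ) : Submodule ℂ D.Formal where
  carrier := {x | Memℓp (fun l => weight s l • x l) 2}
  add_mem' {x y} hx hy := by
    have h := Memℓp.add hx hy
    have e : (fun l => weight s l • (x + y) l) =
        (fun l => weight s l • x l) + (fun l => weight s l • y l) := by
      funext l; simp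
    simpa only [Set.mem_ofPred_eq, e] using h
  zero_mem' := by
    have e : (fun l => weight s l • (0 : D.Formal) l) = 0 := by funext l; simp
    simpa only [Set.mem_ofPred_eq, e] using zero_memℓp
  smul_mem' c x hx := by
    have h := Memℓp.const_smul hx c
    have e : (fun l => weight s l • (c • x) l) = c • (fun l => weight s l • x l) := by
      funext l; simp [smul_comm c]
    simpa only [Set.mem_ofPred_eq, e] using h

/-- The isometry `(I + A²)^(s/2)` from `H^s` to the Hilbert sum of the eigenspaces, `H`. -/
def sobolevIso (D : DiracSystem H) (s : ℝ) : D.sobolev s →ₗ[ℂ] lp (fun l => D.eig l) 2 where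
  toFun x := ⟨fun l => weight s l • (x : D.Formal) l, x.2⟩
  map_add' x y := by
    apply lp.ext
    funext l
    exact smul_add (weight s l) ((x : D.Formal) l) ((y : D.Formal) l)
  map_smul' c x := by
    apply lp.ext
    funext l
    exact smul_comm (weight s l) c ((x : D.Formal) l)

open Classical in
/-- The spectral projection `Q_J` of `A`, on formal sums. -/
def Q (D : DiracSystem H) (J : Set ℝ) : D.Formal →ₗ[ℂ] D.Formal where
  toFun x l := if l ∈ J then x l else 0
  map_add' x y := by funext l; by_cases h : l ∈ J <;> simp [h]
  map_smul' c x := by funext l; by_cases h : l ∈ J <;> simp [h]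

/-- The extension of `γ` to formal sums; `γ` maps `ker (A + l)` to `ker (A - l)`. -/
def γF (D : DiracSystem H) : D.Formal →ₗ[ℂ] D.Formal where
  toFun x l := ⟨D.γ (x (-l)), D.γ_mem_eig l _ (x (-l)).2⟩
  map_add' x y := by funext l; ext; simp
  map_smul' c x := by funext l; ext; simp

/-- The embedding of `H` into the formal sums: the eigenspace components of a vector. -/
def incl (D : DiracSystem H) : H →ₗ[ℂ] D.Formal where
  toFun x l := (D.eig l).orthogonalProjectionOnto x
  map_add' x y := by funext l; simp
  map_smul' c x := by funext l; simp

/-- `H^{1/2}` as a subspace of `H`. -/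
def Hhalf (D : DiracSystem H) : Submodule ℂ H := (D.sobolev (1 / 2)).comap D.incl

/-- `H_< = Q_{(-∞,0)} H`, the closed span of the eigenvectors with negative eigenvalue. -/
def Hneg (D : DiracSystem H) : Submodule ℂ H :=
  (⨆ l ∈ Set.Iio (0 : ℝ), D.eig l).topologicalClosure

/-- The space of boundary values `Ȟ = H^{1/2}_{(-∞,0]} ⊕ H^{-1/2}_{(0,∞)}`. -/
def check (D : DiracSystem H) : Submodule ℂ D.Formal :=
  (D.sobolev (1 / 2)).comap (D.Q (Set.Iic 0)) ⊓ (D.sobolev (-(1 / 2))).comap (D.Q (Set.Ioi 0))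

theorem mem_check (D : DiracSystem H) (x : D.Formal) : x ∈ D.check ↔
    D.Q (Set.Iic 0) x ∈ D.sobolev (1 / 2) ∧ D.Q (Set.Ioi 0) x ∈ D.sobolev (-(1 / 2)) := by
  rw [check, Submodule.mem_inf, Submodule.mem_comap, Submodule.mem_comap]

/-- The two components of an element of `Ȟ`, measured in the norms of `H^{1/2}` and
`H^{-1/2}`. -/
def checkEmb (D : DiracSystem H) :
    D.check →ₗ[ℂ] lp (fun l => D.eig l) 2 × lp (fun l => D.eig l) 2 :=
  LinearMap.prod
    (D.sobolevIso (1 / 2) ∘ₗ (D.Q (Set.Iic 0)).restrict (fun x hx => ((D.mem_check x).mp hx).1))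
    (D.sobolevIso (-(1 / 2)) ∘ₗ (D.Q (Set.Ioi 0)).restrict (fun x hx => ((D.mem_check x).mp hx).2))

/-- The topology of `Ȟ` as the direct sum of the Hilbert spaces `H^{1/2}_{(-∞,0]}` and
`H^{-1/2}_{(0,∞)}`; it is not the topology of componentwise convergence. -/
abbrev checkTopology (D : DiracSystem H) : TopologicalSpace D.check :=
  TopologicalSpace.induced D.checkEmb inferInstance

/-- The pairing `B_s(x,y) = ⟨(I + A²)^(s/2) x, (I + A²)^(-s/2) y⟩` of `H^s` and `H^{-s}`. It is
linear in `x` and antilinear in `y`. -/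
def pairing (D : DiracSystem H) (s : ℝ) (x y : D.Formal) : ℂ :=
  ∑' l : ℝ, inner ℂ (weight (-s) l • y l) (weight s l • x l)

/-- The boundary form
`ω(x,y) = B_{-1/2}(Q_{>0} x, γ Q_{<0} y) + B_{1/2}(Q_{≤0} x, γ Q_{≥0} y)`; on `H^{1/2}` it is
`⟨x, γ y⟩`. -/
def ω (D : DiracSystem H) (x y : D.Formal) : ℂ :=
  D.pairing (-(1 / 2)) (D.Q (Set.Ioi 0) x) (D.γF (D.Q (Set.Iio 0) y)) +
    D.pairing (1 / 2) (D.Q (Set.Iic 0) x) (D.γF (D.Q (Set.Ici 0) y))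

theorem Q_mem_sobolev (D : DiracSystem H) (s : ℝ) (J : Set ℝ) {x : D.Formal}
    (hx : x ∈ D.sobolev s) : D.Q J x ∈ D.sobolev s := by
  have h : Memℓp (fun l => weight s l • x l) 2 := hx
  refine Memℓp.mono' h (fun l => ?_)
  by_cases hl : l ∈ J <;> simp [Q, hl]

theorem γF_mem_sobolev (D : DiracSystem H) (s : ℝ) {x : D.Formal}
    (hx : x ∈ D.sobolev s) : D.γF x ∈ D.sobolev s := by
  have h : Memℓp (fun l => weight s l • x l) 2 := hx
  change Memℓp (fun l => weight s l • D.γF x l) 2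
  rw [memℓp_gen_iff (by norm_num)] at h ⊢
  have h' := (Equiv.neg ℝ).summable_iff.mpr h
  refine h'.congr (fun l => ?_)
  simp [γF, norm_smul, weight, D.norm_γ]

theorem summable_pairing (D : DiracSystem H) (s : ℝ) {x y : D.Formal}
    (hx : x ∈ D.sobolev s) (hy : y ∈ D.sobolev (-s)) :
    Summable (fun l => inner ℂ (weight (-s) l • y l) (weight s l • x l)) :=
  lp.summable_inner (𝕜 := ℂ) (D.sobolevIso (-s) ⟨y, hy⟩) (D.sobolevIso s ⟨x, hx⟩)

theorem pairing_add_right (D : DiracSystem H) (s : ℝ) {x y z : D.Formal}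
    (hx : x ∈ D.sobolev s) (hy : y ∈ D.sobolev (-s)) (hz : z ∈ D.sobolev (-s)) :
    D.pairing s x (y + z) = D.pairing s x y + D.pairing s x z := by
  rw [pairing, pairing, pairing,
    ← (D.summable_pairing s hx hy).tsum_add (D.summable_pairing s hx hz)]
  refine tsum_congr (fun l => ?_)
  rw [Pi.add_apply, smul_add, inner_add_left]

theorem pairing_smul_right (D : DiracSystem H) (s : ℝ) (x y : D.Formal) (c : ℂ) :
    D.pairing s x (c • y) = (starRingEnd ℂ) c * D.pairing s x y := by
  rw [pairing, pairing, ← tsum_mul_left]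
  refine tsum_congr (fun l => ?_)
  rw [Pi.smul_apply, smul_comm, inner_smul_left]

theorem Q_neg_mem (D : DiracSystem H) {y : D.Formal} (hy : y ∈ D.check) :
    D.Q (Set.Iio 0) y ∈ D.sobolev (1 / 2) := by
  have h := D.Q_mem_sobolev (1 / 2) (Set.Iio 0) ((D.mem_check y).mp hy).1
  have e : D.Q (Set.Iio 0) (D.Q (Set.Iic 0) y) = D.Q (Set.Iio 0) y := by
    funext l
    by_cases hl : l < 0
    · simp [Q, hl, hl.le]
    · simp [Q, hl]
  rwa [e] at h

theorem sobolev_anti (D : DiracSystem H) {s t : ℝ} (hst : s ≤ t) :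
    D.sobolev t ≤ D.sobolev s := by
  intro x hx
  have h : Memℓp (fun l => weight t l • x l) 2 := hx
  refine Memℓp.mono' h (fun l => ?_)
  have h1 : (1 : ℝ) ≤ 1 + l ^ 2 := by nlinarith [sq_nonneg l]
  simp only [norm_smul, weight, Complex.norm_real, Real.norm_eq_abs]
  rw [abs_of_nonneg (Real.rpow_nonneg (by linarith) _),
    abs_of_nonneg (Real.rpow_nonneg (by linarith) _)]
  gcongr

theorem Q_nonneg_mem (D : DiracSystem H) {y : D.Formal} (hy : y ∈ D.check) :
    D.Q (Set.Ici 0) y ∈ D.sobolev (-(1 / 2)) := by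
  have h1 := D.Q_mem_sobolev (-(1 / 2)) (Set.Ici 0)
    (D.sobolev_anti (by norm_num : -(1 / 2 : ℝ) ≤ 1 / 2) ((D.mem_check y).mp hy).1)
  have h2 := (D.sobolev (-(1 / 2))).add_mem h1 ((D.mem_check y).mp hy).2
  have e : D.Q (Set.Ici 0) (D.Q (Set.Iic 0) y) + D.Q (Set.Ioi 0) y = D.Q (Set.Ici 0) y := by
    funext l
    rcases lt_trichotomy l 0 with hl | hl | hl
    · simp [Q, hl.not_ge, hl.not_gt]
    · simp [Q, hl]
    · simp [Q, hl.le, hl, hl.not_ge]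
  rwa [e] at h2

theorem ω_add_right (D : DiracSystem H) {x y z : D.Formal} (hx : x ∈ D.check)
    (hy : y ∈ D.check) (hz : z ∈ D.check) : D.ω x (y + z) = D.ω x y + D.ω x z := by
  have h (u : D.Formal) (hu : u ∈ D.check) :
      D.γF (D.Q (Set.Iio 0) u) ∈ D.sobolev (-(-(1 / 2))) := by
    rw [neg_neg]
    exact D.γF_mem_sobolev _ (D.Q_neg_mem hu)
  have h' (u : D.Formal) (hu : u ∈ D.check) :
      D.γF (D.Q (Set.Ici 0) u) ∈ D.sobolev (-(1 / 2)) :=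
    D.γF_mem_sobolev _ (D.Q_nonneg_mem hu)
  simp only [ω, map_add]
  rw [D.pairing_add_right _ ((D.mem_check x).mp hx).2 (h y hy) (h z hz),
    D.pairing_add_right _ ((D.mem_check x).mp hx).1 (h' y hy) (h' z hz)]
  ring

theorem ω_smul_right (D : DiracSystem H) (x y : D.Formal) (c : ℂ) :
    D.ω x (c • y) = (starRingEnd ℂ) c * D.ω x y := by
  simp only [ω, map_smul, pairing_smul_right]
  ring

/-- The annihilator `B^a = {y ∈ Ȟ : ω(x,y) = 0 for all x ∈ B}` of a subspace `B` of `Ȟ`. -/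
def annihilator (D : DiracSystem H) (B : Submodule ℂ D.Formal) : Submodule ℂ D.Formal where
  carrier := {y | y ∈ D.check ∧ ∀ x ∈ B ⊓ D.check, D.ω x y = 0}
  add_mem' {y z} hy hz := by
    refine ⟨D.check.add_mem hy.1 hz.1, fun x hx => ?_⟩
    rw [D.ω_add_right hx.2 hy.1 hz.1, hy.2 x hx, hz.2 x hx, add_zero]
  zero_mem' := by
    refine ⟨D.check.zero_mem, fun x _ => ?_⟩
    have h := D.ω_smul_right x 0 0
    simpa using h
  smul_mem' c y hy := by
    refine ⟨D.check.smul_mem c hy.1, fun x hx => ?_⟩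
    rw [D.ω_smul_right, hy.2 x hx, mul_zero]

/-- A boundary condition is a closed linear subspace of `Ȟ`. -/
def IsBoundaryCondition (D : DiracSystem H) (B : Submodule ℂ D.Formal) : Prop :=
  B ≤ D.check ∧ IsClosed[D.checkTopology] (B.comap D.check.subtype : Set D.check)

/-- A boundary condition is regular if it is contained in `H^{1/2}`. -/
def IsRegular (D : DiracSystem H) (B : Submodule ℂ D.Formal) : Prop :=
  D.IsBoundaryCondition B ∧ B ≤ D.sobolev (1 / 2)

/-- A boundary condition `B` is elliptic if `B` and `B^a` are regular. -/
def IsElliptic (D : DiracSystem H) (B : Submodule ℂ D.Formal) : Prop :=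
  D.IsRegular B ∧ D.IsRegular (D.annihilator B)

/-- A boundary condition `B` is self-adjoint if `B = B^a`. -/
def IsSelfAdjointBC (D : DiracSystem H) (B : Submodule ℂ D.Formal) : Prop :=
  D.IsBoundaryCondition B ∧ B = D.annihilator B

/-- `H^+ = {x : i γ x = x}`. -/
def Hplus (D : DiracSystem H) : Submodule ℂ H where
  carrier := {x | Complex.I • D.γ x = x}
  add_mem' {x y} hx hy := by
    simp only [Set.mem_ofPred_eq] at hx hy ⊢
    rw [map_add, smul_add, hx, hy]
  zero_mem' := by simp
  smul_mem' c x hx := by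
    simp only [Set.mem_ofPred_eq] at hx ⊢
    rw [map_smul, smul_comm, hx]

/-- `H^- = {x : i γ x = -x}`. -/
def Hminus (D : DiracSystem H) : Submodule ℂ H where
  carrier := {x | Complex.I • D.γ x = -x}
  add_mem' {x y} hx hy := by
    simp only [Set.mem_ofPred_eq] at hx hy ⊢
    rw [map_add, smul_add, hx, hy, neg_add]
  zero_mem' := by simp
  smul_mem' c x hx := by
    simp only [Set.mem_ofPred_eq] at hx ⊢
    rw [map_smul, smul_comm, hx, smul_neg]

theorem A_mem_Hminus (D : DiracSystem H) (x : D.A.domain) (hx : (x : H) ∈ D.Hplus) :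
    D.A x ∈ D.Hminus := by
  obtain ⟨h, e⟩ := D.anticomm x
  have hx' : Complex.I • D.γ (x : H) = x := hx
  have e2 : Complex.I • (⟨D.γ (x : H), h⟩ : D.A.domain) = x := Subtype.ext hx'
  change Complex.I • D.γ (D.A x) = -D.A x
  rw [← neg_eq_iff_eq_neg.mpr e, smul_neg, ← LinearPMap.map_smul, e2]

/-- The operator `A^+ : H^+ → H^-`, the restriction of `A` to `H^+`, with domain
`H^+ ∩ dom A`. -/
def Aplus (D : DiracSystem H) : D.Hplus →ₗ.[ℂ] D.Hminus where
  domain := D.A.domain.comap D.Hplus.subtype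
  toFun :=
    { toFun := fun x => ⟨D.A ⟨((x : D.Hplus) : H), x.2⟩,
        D.A_mem_Hminus ⟨((x : D.Hplus) : H), x.2⟩ (x : D.Hplus).2⟩
      map_add' := fun x y => by
        ext
        exact D.A.map_add ⟨((x : D.Hplus) : H), x.2⟩ ⟨((y : D.Hplus) : H), y.2⟩
      map_smul' := fun c x => by
        ext
        exact D.A.map_smul c ⟨((x : D.Hplus) : H), x.2⟩ }

/-- `H_0 = ker A` is a Hermitian symplectic space: the `±1`-eigenspaces of `i γ` on `H_0` have
the same dimension. -/
def IsHermitianSymplectic (D : DiracSystem H) : Prop :=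
  Module.rank ℂ ↥(D.eig 0 ⊓ D.Hplus) = Module.rank ℂ ↥(D.eig 0 ⊓ D.Hminus)

/-- `L ⊆ H_0 = ker A` is Lagrangian: `L ⟂ γ L` and `L ⊕ γ L = H_0`. -/
def IsLagrangian (D : DiracSystem H) (L : Submodule ℂ H) : Prop :=
  L ⟂ L.map D.γ.toLinearMap ∧ L ⊔ L.map D.γ.toLinearMap = D.eig 0

/-- The data describing regular self-adjoint boundary conditions: a Lagrangian subspace `L` of
`H_0`, an orthogonal decomposition `H_< = F ⊕ V` with `F ⊆ H^{1/2}` of finite dimension, and a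
bounded operator `g = g*` on `V ⊕ L` which restricts to `H^{1/2}`. As `g* = g`, this is
`1/2`-smoothness of `g`. -/
structure IsData (D : DiracSystem H) (L F V : Submodule ℂ H)
    (g : ↥(V ⊔ L) →L[ℂ] ↥(V ⊔ L)) : Prop where
  lagrangian : D.IsLagrangian L
  finite : FiniteDimensional ℂ F
  smooth_F : F ≤ D.Hhalf
  ortho : F ⟂ V
  sup_eq : F ⊔ V = D.Hneg
  symm : g.toLinearMap.IsSymmetric
  smooth_g : ∀ w : ↥(V ⊔ L), (w : H) ∈ D.Hhalf → (g w : H) ∈ D.Hhalf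

/-- The subspace `{w + γ g w : w ∈ W ∩ H^{1/2}}` of `H`. -/
def graphPart (D : DiracSystem H) (W : Submodule ℂ H) (g : W →L[ℂ] W) : Submodule ℂ H :=
  (D.Hhalf.comap W.subtype).map
    (W.subtype + D.γ.toLinearMap ∘ₗ W.subtype ∘ₗ g.toLinearMap)

end DiracSystem

end

/-! The compact embedding of dom A makes (I + A²)⁻¹ compact, so H is the Hilbert sum of the
eigenspaces of A. Everything becomes a weighted ℓ²-sum on which A is diagonal and γ exchanges ker (A
- l) and ker (A + l). Bounded spectral subspaces are finite-dimensional. Hence the kernel and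
cokernel of A⁺ are the two eigenspaces of iγ on ker A, and the index compares their dimensions. A
Lagrangian subspace projects isomorphically onto both eigenspaces; conversely, the graph of a
unitary map between them is Lagrangian.

Rescaling by weights which are inverse to each other at l and -l (`checkWeight`) identifies Ȟ with H
and ω with the bounded form ⟨r, γ s⟩ (`ω_ofL2`). Boundary conditions are then closed subspaces of H,
and annihilators are orthogonal complements up to γ.

Data (L, F, V, g) give an isotropic B because g is symmetric and V ⊕ L is isotropic. Testing an
annihilating element against the pieces of B shows that it belongs to B (`IsData.annihilator_le`).
With F = 0 and g = 0 this proves existence.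

Conversely let B be regular and self-adjoint. By the closed graph theorem the norm of H^{1/2} is
bounded by that of Ȟ on B, so high positive frequencies are controlled by the others
(`exists_cutoff`). It follows that F = {x ∈ H_< : γ x ∈ B} is finite-dimensional and that the
nonpositive parts of B form a closed subspace, which self-adjointness then identifies
(`exists_proj_eq`). The kernel parts of elements without negative part form a Lagrangian L. Modulo γ
F, B is the graph of an operator on (V ⊕ L) ∩ H^{1/2}, symmetric because B is isotropic. Krein's
lemma (`exists_bound_of_symmetric`) bounds it in H, and its extension g produces a self-adjoint
condition inside B; self-adjointness of both forces equality. -/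

noncomputable section

namespace DiracSystem

variable {H : Type*} [NormedAddCommGroup H] [InnerProductSpace ℂ H] [CompleteSpace H]

/-! ### The spectral theorem for A -/

/-- A pair belongs to the graph of `A` as soon as it does so weakly. -/
theorem mem_graph_iff_inner (D : DiracSystem H) (x y : H) :
    (x, y) ∈ D.A.graph ↔ ∀ a b, (a, b) ∈ D.A.graph → inner ℂ b x = inner ℂ a y := by
  have h := LinearPMap.adjoint_graph_eq_graph_adjoint D.selfAdjoint.dense_domain
  rw [LinearPMap.isSelfAdjoint_def.mp D.selfAdjoint] at h
  conv_lhs => rw [h]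
  simp only [Submodule.mem_adjoint_iff, sub_eq_zero]

theorem mem_eig_iff_graph (D : DiracSystem H) (l : ℝ) (x : H) :
    x ∈ D.eig l ↔ (x, (l : ℂ) • x) ∈ D.A.graph := by
  simp [eig]

/-- The graph of `A` as a subspace of the Hilbert space `H × H`. -/
def graphL2 (D : DiracSystem H) : Submodule ℂ (WithLp 2 (H × H)) :=
  D.A.graph.comap (WithLp.linearEquiv 2 ℂ (H × H)).toLinearMap

theorem isClosed_graphL2 (D : DiracSystem H) : IsClosed (D.graphL2 : Set (WithLp 2 (H × H))) := by
  have hA : IsClosed (D.A.graph : Set (H × H)) := D.selfAdjoint.isClosed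
  exact hA.preimage (WithLp.prod_continuous_ofLp 2 H H)

instance instCompleteGraphL2 (D : DiracSystem H) : CompleteSpace D.graphL2 :=
  D.isClosed_graphL2.completeSpace_coe

/-- The operator `(I + A²)⁻¹`, from the orthogonal projection to the graph of `A`. -/
def resolventSq (D : DiracSystem H) : H →L[ℂ] H :=
  (WithLp.fstL 2 ℂ H H) ∘L D.graphL2.subtypeL ∘L D.graphL2.orthogonalProjectionOnto ∘L
    (WithLp.prodContinuousLinearEquiv 2 ℂ H H).symm.toContinuousLinearMap ∘L
      (ContinuousLinearMap.inl ℂ H H)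

/-- Let (u, b) be the projection of (x, 0) to the graph. The remainder (x - u, -b) is orthogonal to
the graph, which says weakly that A b = x - u. As b = A u, this is u + A² u = x. -/
theorem resolventSq_spec (D : DiracSystem H) (x : H) :
    ∃ b, (D.resolventSq x, b) ∈ D.A.graph ∧ (b, x - D.resolventSq x) ∈ D.A.graph := by
  set p := D.graphL2.orthogonalProjectionOnto (WithLp.toLp 2 (x, 0)) with hp
  have h1 : D.resolventSq x = (p : WithLp 2 (H × H)).fst := rfl
  refine ⟨(p : WithLp 2 (H × H)).snd, p.2, ?_⟩
  rw [mem_graph_iff_inner]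
  intro a b hab
  have := Submodule.starProjection_inner_eq_zero (K := D.graphL2)
    (WithLp.toLp 2 (x, (0 : H))) (WithLp.toLp 2 (a, b)) hab
  rw [Submodule.starProjection_apply, ← hp, ← inner_conj_symm] at this
  replace this := (map_eq_zero (starRingEnd ℂ)).mp this
  simp only [WithLp.prod_inner_apply, WithLp.sub_fst, WithLp.sub_snd, WithLp.ofLp_fst,
    WithLp.ofLp_snd] at this
  rw [WithLp.toLp_fst, WithLp.toLp_snd, zero_sub, inner_neg_right] at this
  rw [h1]
  linear_combination -this

theorem isCompactOperator_resolventSq (D : DiracSystem H) :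
    IsCompactOperator D.resolventSq := by
  have h : IsCompactOperator (fun p : D.graphL2 => (p : WithLp 2 (H × H)).fst) := by
    obtain ⟨K, hK, hK'⟩ := D.discrete
    refine ⟨K, hK, ?_⟩
    have hc : Continuous (fun p : D.graphL2 =>
        (⟨WithLp.ofLp (p : WithLp 2 (H × H)), p.2⟩ : D.A.graph)) :=
      Continuous.subtype_mk ((WithLp.prod_continuous_ofLp 2 H H).comp continuous_subtype_val) _
    exact hc.continuousAt (x := 0) hK'
  exact IsCompactOperator.comp_clm (f := (WithLp.fstL 2 ℂ H H) ∘L D.graphL2.subtypeL) h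
    (D.graphL2.orthogonalProjectionOnto ∘L
      (WithLp.prodContinuousLinearEquiv 2 ℂ H H).symm.toContinuousLinearMap ∘L
        (ContinuousLinearMap.inl ℂ H H))

theorem isSymmetric_resolventSq (D : DiracSystem H) :
    (D.resolventSq : H →ₗ[ℂ] H).IsSymmetric := by
  intro x y
  obtain ⟨b, hb, hb'⟩ := D.resolventSq_spec x
  obtain ⟨c, hc, hc'⟩ := D.resolventSq_spec y
  have h1 := (D.mem_graph_iff_inner _ _).mp hc' _ _ hb
  have h2 := (D.mem_graph_iff_inner _ _).mp hc _ _ hb'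
  simp only [ContinuousLinearMap.coe_coe, inner_sub_right, inner_sub_left] at h1 h2 ⊢
  linear_combination -h1 - h2

theorem snd_eq_zero_of_mem_graph (D : DiracSystem H) {b : H} (h : ((0 : H), b) ∈ D.A.graph) :
    b = 0 :=
  LinearPMap.graph_fst_eq_zero_snd _ h rfl

/-- On an eigenvector u one has A² u = l² u with l² = μ⁻¹ - 1. If l ≠ 0, then u is a multiple of (A
u + l u) + (l u - A u), whose summands are eigenvectors of A for l and -l; if l = 0, then A u = 0.
-/
theorem eigenspace_resolventSq_le (D : DiracSystem H) (μ : ℂ) :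
    Module.End.eigenspace (D.resolventSq : Module.End ℂ H) μ ≤ ⨆ l, D.eig l := by
  intro x hx
  rw [Module.End.mem_eigenspace_iff] at hx
  replace hx : D.resolventSq x = μ • x := hx
  obtain ⟨b, hb, hb'⟩ := D.resolventSq_spec x
  rcases eq_or_ne x 0 with rfl | hx0
  · exact zero_mem _
  have hμ : μ ≠ 0 := by
    rintro rfl
    rw [hx, zero_smul] at hb hb'
    obtain rfl := D.snd_eq_zero_of_mem_graph hb
    exact hx0 (by simpa using D.snd_eq_zero_of_mem_graph hb')
  set u := D.resolventSq x with hu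
  have hxu : x = μ⁻¹ • u := by rw [hx, smul_smul, inv_mul_cancel₀ hμ, one_smul]
  have hu0 : u ≠ 0 := by rw [hx]; exact smul_ne_zero hμ hx0
  have hun : (‖u‖ : ℂ) ≠ 0 := by simpa using hu0
  have key := (D.mem_graph_iff_inner _ _).mp hb' _ _ hb
  obtain ⟨l, hl⟩ : ∃ l : ℝ, μ⁻¹ - 1 = (l : ℂ) ^ 2 := by
    -- Here b = A u, and symmetry gives ‖b‖² = ⟨u, A² u⟩ = (μ⁻¹ - 1) ‖u‖².
    refine ⟨‖b‖ / ‖u‖, ?_⟩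
    rw [inner_sub_right, hxu, inner_smul_right, inner_self_eq_norm_sq_to_K,
      inner_self_eq_norm_sq_to_K] at key
    push_cast
    field_simp
    simp only [Complex.coe_algebraMap] at key
    field_simp at key
    linear_combination -key
  have hb2 : (b, ((l : ℂ) ^ 2) • u) ∈ D.A.graph := by
    have e : x - u = ((l : ℂ) ^ 2) • u := by rw [← hl, sub_smul, one_smul, ← hxu]
    rwa [e] at hb'
  rw [hxu]
  refine Submodule.smul_mem _ _ ?_
  rcases eq_or_ne l 0 with rfl | hl0
  · have hb0 : b = 0 := by
      have h := (D.mem_graph_iff_inner _ _).mp hb2 _ _ hb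
      simpa using h
    rw [hb0] at hb
    refine Submodule.mem_iSup_of_mem 0 ?_
    rw [mem_eig_iff_graph]
    simpa using hb
  · have hy : b + (l : ℂ) • u ∈ D.eig l := by
      rw [mem_eig_iff_graph]
      have := D.A.graph.add_mem hb2 (D.A.graph.smul_mem (l : ℂ) hb)
      convert this using 1
      refine Prod.ext rfl ?_
      simp only [Prod.snd_add, Prod.smul_snd, smul_add, smul_smul, pow_two, add_comm]
    have hz : (l : ℂ) • u - b ∈ D.eig (-l) := by
      rw [mem_eig_iff_graph]
      have := D.A.graph.sub_mem (D.A.graph.smul_mem (l : ℂ) hb) hb2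
      convert this using 1
      refine Prod.ext rfl ?_
      simp only [Prod.snd_sub, Prod.smul_snd, smul_sub, smul_smul, pow_two, Complex.ofReal_neg,
        neg_mul, neg_smul]
      abel
    have e : u = ((2 * l : ℂ)⁻¹) • ((b + (l : ℂ) • u) + ((l : ℂ) • u - b)) := by
      have : (2 * l : ℂ) ≠ 0 := by simpa using hl0
      rw [eq_inv_smul_iff₀ this, mul_smul, two_smul]
      abel
    rw [e]
    exact Submodule.smul_mem _ _ (Submodule.add_mem _ (Submodule.mem_iSup_of_mem _ hy)
      (Submodule.mem_iSup_of_mem _ hz))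

theorem orthogonal_iSup_eig (D : DiracSystem H) : (⨆ l, D.eig l)ᗮ = ⊥ := by
  have h := ContinuousLinearMap.orthogonalComplement_iSup_eigenspaces_eq_bot
    D.isCompactOperator_resolventSq D.isSymmetric_resolventSq
  rw [eq_bot_iff, ← h]
  exact Submodule.orthogonal_le (iSup_le D.eigenspace_resolventSq_le)

theorem inner_eig_of_graph (D : DiracSystem H) {l : ℝ} {x a b : H} (hx : x ∈ D.eig l)
    (hab : (a, b) ∈ D.A.graph) : inner ℂ x b = l * inner ℂ x a := by
  rw [mem_eig_iff_graph] at hx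
  have := (D.mem_graph_iff_inner _ _).mp hab _ _ hx
  rw [← this, inner_smul_left]
  simp

theorem orthogonalFamily_eig (D : DiracSystem H) :
    OrthogonalFamily ℂ (fun l => D.eig l) (fun l => (D.eig l).subtypeₗᵢ) := by
  intro l m hlm x y
  have h := D.inner_eig_of_graph x.2 ((D.mem_eig_iff_graph m _).mp y.2)
  rw [inner_smul_right] at h
  have h2 : ((l : ℂ) - m) ≠ 0 := by
    rw [sub_ne_zero]; exact_mod_cast hlm
  refine (mul_eq_zero.mp (?_ : ((l : ℂ) - m) * _ = 0)).resolve_left h2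
  change ((l : ℂ) - m) * inner ℂ (x : H) (y : H) = 0
  linear_combination -h

theorem isHilbertSum (D : DiracSystem H) :
    IsHilbertSum ℂ (fun l => D.eig l) (fun l => (D.eig l).subtypeₗᵢ) := by
  refine IsHilbertSum.mkInternal _ D.orthogonalFamily_eig ?_
  rw [top_le_iff, Submodule.topologicalClosure_eq_top_iff]
  exact D.orthogonal_iSup_eig

/-! ### Eigenspace components of vectors -/

/-- The identification of `H` with the Hilbert sum of the eigenspaces of `A`. -/
def iso (D : DiracSystem H) : H ≃ₗᵢ[ℂ] lp (fun l => D.eig l) 2 := D.isHilbertSum.linearIsometryEquiv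

open Classical in
theorem iso_symm_single (D : DiracSystem H) (l : ℝ) (x : D.eig l) :
    D.iso.symm (lp.single 2 l x) = x :=
  D.isHilbertSum.linearIsometryEquiv_symm_apply_single x

theorem iso_apply (D : DiracSystem H) (x : H) (l : ℝ) : D.iso x l = D.incl x l := by
  classical
  refine ext_inner_left ℂ (fun v => ?_)
  have h := lp.inner_single_left (𝕜 := ℂ) (G := fun l => D.eig l) l v (D.iso x)
  rw [← h, ← LinearIsometryEquiv.inner_map_map D.iso.symm, D.iso_symm_single,
    LinearIsometryEquiv.symm_apply_apply]
  change _ = inner ℂ v ((D.eig l).orthogonalProjectionOnto x)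
  rw [Submodule.inner_orthogonalProjectionOnto_eq_of_mem_left]

theorem coe_iso (D : DiracSystem H) (x : H) : (D.iso x : D.Formal) = D.incl x :=
  funext (D.iso_apply x)

theorem incl_iso_symm (D : DiracSystem H) (f : lp (fun l => D.eig l) 2) :
    D.incl (D.iso.symm f) = f := by
  rw [← coe_iso, LinearIsometryEquiv.apply_symm_apply]

theorem memℓp_incl (D : DiracSystem H) (x : H) : Memℓp (D.incl x) 2 := by
  rw [← coe_iso]
  exact lp.memℓp _

theorem exists_incl_eq (D : DiracSystem H) {x : D.Formal} (hx : Memℓp x 2) :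
    ∃ a, D.incl a = x :=
  ⟨D.iso.symm ⟨x, hx⟩, D.incl_iso_symm _⟩

theorem incl_injective (D : DiracSystem H) : Function.Injective D.incl := by
  intro x y h
  refine D.iso.injective (lp.ext ?_)
  rw [coe_iso, coe_iso, h]

theorem hasSum_inner_incl (D : DiracSystem H) (x y : H) :
    HasSum (fun l => inner ℂ (D.incl x l) (D.incl y l)) (inner ℂ x y) := by
  have h := lp.hasSum_inner (𝕜 := ℂ) (D.iso x) (D.iso y)
  simpa only [iso_apply, LinearIsometryEquiv.inner_map_map] using h

theorem coe_incl_of_mem (D : DiracSystem H) {l : ℝ} {x : H} (hx : x ∈ D.eig l) :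
    (D.incl x l : H) = x :=
  congrArg Subtype.val (Submodule.orthogonalProjectionOnto_mem_subspace_eq_self (K := D.eig l) ⟨x, hx⟩)

theorem inner_coe_incl (D : DiracSystem H) {l : ℝ} {v : H} (hv : v ∈ D.eig l) (x : H) :
    inner ℂ v (D.incl x l : H) = inner ℂ v x :=
  Submodule.inner_orthogonalProjectionOnto_eq_of_mem_left (K := D.eig l) ⟨v, hv⟩ x

/-- A is diagonal on components. A pair satisfying the componentwise relation satisfies the weak one
by Parseval, hence lies in the graph because A is self-adjoint. -/
theorem mem_graph_iff_incl (D : DiracSystem H) (x y : H) :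
    (x, y) ∈ D.A.graph ↔ ∀ l : ℝ, D.incl y l = (l : ℂ) • D.incl x l := by
  have key : ∀ x y : H, (x, y) ∈ D.A.graph → ∀ l : ℝ, D.incl y l = (l : ℂ) • D.incl x l := by
    intro x y h l
    refine ext_inner_left ℂ (fun v => ?_)
    have := D.inner_eig_of_graph v.2 h
    rw [inner_smul_right, Submodule.coe_inner, Submodule.coe_inner, inner_coe_incl _ v.2,
      inner_coe_incl _ v.2, this]
  refine ⟨key x y, fun h => ?_⟩
  rw [mem_graph_iff_inner]
  intro a b hab
  refine (D.hasSum_inner_incl b x).unique ?_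
  convert D.hasSum_inner_incl a y using 2 with l
  rw [key a b hab l, h l, inner_smul_left, inner_smul_right]
  simp

theorem incl_of_mem (D : DiracSystem H) {l m : ℝ} {x : H} (hx : x ∈ D.eig l) (hlm : l ≠ m) :
    D.incl x m = 0 := by
  refine ext_inner_left ℂ (fun v => ?_)
  rw [Submodule.coe_inner, inner_coe_incl _ v.2, inner_zero_right]
  exact D.orthogonalFamily_eig hlm.symm v ⟨x, hx⟩

theorem mem_eig_iff_incl (D : DiracSystem H) (l : ℝ) (x : H) :
    x ∈ D.eig l ↔ ∀ m, m ≠ l → D.incl x m = 0 := by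
  refine ⟨fun h m hm => D.incl_of_mem h hm.symm, fun h => ?_⟩
  rw [mem_eig_iff_graph, mem_graph_iff_incl]
  intro m
  rcases eq_or_ne m l with rfl | hm
  · rw [map_smul, Pi.smul_apply]
  · rw [map_smul, Pi.smul_apply, h m hm, smul_zero, smul_zero]

theorem norm_sq_eq_tsum (D : DiracSystem H) (x : H) :
    HasSum (fun l => ‖D.incl x l‖ ^ 2) (‖x‖ ^ 2) := by
  have h := (D.hasSum_inner_incl x x)
  have := Complex.hasSum_re h
  simpa [inner_self_eq_norm_sq_to_K, ← Complex.ofReal_pow] using this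

/-! ### Spectral subspaces and discreteness -/

/-- The spectral subspace of `A` for the set `J`. -/
def spec (D : DiracSystem H) (J : Set ℝ) : Submodule ℂ H where
  carrier := {x | ∀ l, l ∉ J → D.incl x l = 0}
  add_mem' {x y} hx hy l hl := by simp [hx l hl, hy l hl]
  zero_mem' l _ := by simp
  smul_mem' c x hx l hl := by simp [hx l hl]

theorem mem_spec (D : DiracSystem H) (J : Set ℝ) (x : H) :
    x ∈ D.spec J ↔ ∀ l, l ∉ J → D.incl x l = 0 := Iff.rfl

theorem continuous_incl_apply (D : DiracSystem H) (l : ℝ) : Continuous (fun x => D.incl x l) :=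
  (D.eig l).orthogonalProjectionOnto.continuous

theorem isClosed_spec (D : DiracSystem H) (J : Set ℝ) : IsClosed (D.spec J : Set H) := by
  have : (D.spec J : Set H) = ⋂ l, ⋂ (_ : l ∉ J), (fun x => D.incl x l) ⁻¹' {0} := by
    ext x; simp [mem_spec]
  rw [this]
  exact isClosed_iInter (fun l => isClosed_iInter (fun _ =>
    isClosed_singleton.preimage (D.continuous_incl_apply l)))

theorem exists_graph_of_bounded (D : DiracSystem H) {R : ℝ} (hR : 0 ≤ R) {x : H}
    (hx : x ∈ D.spec (Set.Icc (-R) R)) : ∃ y, (x, y) ∈ D.A.graph ∧ ‖y‖ ≤ R * ‖x‖ := by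
  have hb (l : ℝ) : ‖(l : ℂ) • D.incl x l‖ ≤ R * ‖D.incl x l‖ := by
    by_cases hl : l ∈ Set.Icc (-R) R
    · rw [norm_smul, Complex.norm_real, Real.norm_eq_abs]
      gcongr
      exact abs_le.mpr hl
    · simp [hx l hl]
  have hm : Memℓp (fun l : ℝ => (l : ℂ) • D.incl x l) 2 := by
    refine Memℓp.mono' (g := fun l => (R : ℂ) • D.incl x l) ((D.memℓp_incl x).const_smul (R : ℂ)) ?_
    intro l
    refine (hb l).trans_eq ?_
    rw [norm_smul, Complex.norm_real, Real.norm_of_nonneg hR]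
  obtain ⟨y, hy⟩ := D.exists_incl_eq hm
  refine ⟨y, (D.mem_graph_iff_incl x y).mpr (fun l => congrFun hy l), ?_⟩
  refine abs_le_of_sq_le_sq' ?_ (by positivity) |>.2
  rw [mul_pow]
  refine hasSum_le (fun l => ?_) (D.norm_sq_eq_tsum y) ((D.norm_sq_eq_tsum x).mul_left (R ^ 2))
  rw [hy, ← mul_pow]
  gcongr
  exact hb l

/-- A is bounded here, so a small closed ball is also small in the graph norm and therefore lies in
a compact set. A normed space with a compact ball is finite-dimensional. -/
theorem finiteDimensional_spec (D : DiracSystem H) (R : ℝ) :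
    FiniteDimensional ℂ (D.spec (Set.Icc (-R) R)) := by
  wlog hR : 0 ≤ R generalizing R
  · have hle : D.spec (Set.Icc (-R) R) ≤ D.spec (Set.Icc (-0) 0) := fun x hx l _ =>
      hx l (fun h => hR (by linarith [h.1, h.2]))
    have := this 0 le_rfl
    exact Submodule.finiteDimensional_of_le hle
  obtain ⟨K, hK, hK'⟩ := D.discrete
  obtain ⟨ε, hε, hball⟩ := Metric.mem_nhds_iff.mp hK'
  set E := D.spec (Set.Icc (-R) R)
  have hcl : IsClosed (E : Set H) := D.isClosed_spec _
  -- On this ball both ‖x‖ and ‖A x‖ ≤ R ‖x‖ stay below ε.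
  have hr : 0 < ε / (2 * (1 + R)) := by positivity
  refine FiniteDimensional.of_isCompact_closedBall ℂ hr (c := (0 : E)) ?_
  rw [Topology.IsEmbedding.subtypeVal.isCompact_iff]
  refine hK.of_isClosed_subset ?_ ?_
  · exact hcl.isClosedEmbedding_subtypeVal.isClosedMap _ Metric.isClosed_closedBall
  · rintro _ ⟨x, hx, rfl⟩
    obtain ⟨y, hy, hyx⟩ := D.exists_graph_of_bounded hR x.2
    have hxn : ‖(x : H)‖ ≤ ε / (2 * (1 + R)) := by simpa using hx
    refine hball (a := ⟨((x : H), y), hy⟩) ?_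
    rw [mem_ball_zero_iff]
    change ‖((x : H), y)‖ < ε
    have h2 : (1 + R) * ‖(x : H)‖ ≤ ε / 2 := by
      calc (1 + R) * ‖(x : H)‖ ≤ (1 + R) * (ε / (2 * (1 + R))) := by gcongr
        _ = ε / 2 := by field_simp
    rw [Prod.norm_mk, max_lt_iff]
    constructor <;> nlinarith [norm_nonneg (x : H)]

theorem inner_γ_left (D : DiracSystem H) (x y : H) :
    inner ℂ (D.γ x) y = -inner ℂ x (D.γ y) := by
  rw [← ContinuousLinearMap.adjoint_inner_right, D.adjoint_γ]
  simp

theorem inner_γ_γ (D : DiracSystem H) (x y : H) :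
    inner ℂ (D.γ x) (D.γ y) = inner ℂ x y := by
  rw [inner_γ_left, D.γ_γ, inner_neg_right, neg_neg]

theorem γ_mem_eig_neg (D : DiracSystem H) {l : ℝ} {x : H} (hx : x ∈ D.eig l) :
    D.γ x ∈ D.eig (-l) :=
  D.γ_mem_eig (-l) x (by rwa [neg_neg])

theorem γ_mem_eig_zero (D : DiracSystem H) {x : H} (hx : x ∈ D.eig 0) : D.γ x ∈ D.eig 0 :=
  D.γ_mem_eig 0 x (by rwa [neg_zero])

/-- γ is skew-adjoint and maps ker (A - l) to ker (A + l), so it intertwines the orthogonal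
projections to these eigenspaces. -/
theorem coe_incl_γ (D : DiracSystem H) (x : H) (l : ℝ) :
    (D.incl (D.γ x) l : H) = D.γ (D.incl x (-l)) := by
  have h : D.incl (D.γ x) l = ⟨D.γ (D.incl x (-l)), D.γ_mem_eig l _ (D.incl x (-l)).2⟩ := by
    refine ext_inner_left ℂ (fun v => ?_)
    rw [Submodule.coe_inner, inner_coe_incl _ v.2, Submodule.coe_inner]
    have h1 := D.inner_γ_left (v : H) x
    have h2 := D.inner_γ_left (v : H) (D.incl x (-l))
    rw [inner_coe_incl _ (D.γ_mem_eig_neg v.2)] at h2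
    exact neg_injective (h1.symm.trans h2)
  rw [h]

theorem incl_γ (D : DiracSystem H) (x : H) : D.incl (D.γ x) = D.γF (D.incl x) :=
  funext (fun l => Subtype.ext (D.coe_incl_γ x l))

instance finiteDimensional_eig_zero (D : DiracSystem H) : FiniteDimensional ℂ (D.eig 0) := by
  have := D.finiteDimensional_spec 0
  refine Submodule.finiteDimensional_of_le (S₂ := D.spec (Set.Icc (-0) 0)) (fun x hx l hl => ?_)
  refine D.incl_of_mem hx ?_
  rintro rfl
  simp at hl

/-- The nonzero eigenvalues of `A` stay away from zero. -/
theorem exists_gap (D : DiracSystem H) :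
    ∃ ε > 0, ∀ l : ℝ, l ≠ 0 → D.eig l ≠ ⊥ → ε ≤ |l| := by
  let s : Set ℝ := {l | l ∈ Set.Icc (-1 : ℝ) 1 ∧ D.eig l ≠ ⊥}
  have hs : s.Finite := by
    have := D.finiteDimensional_spec 1
    choose v hv hv0 using fun l : s => Submodule.exists_mem_ne_zero_of_ne_bot l.2.2
    let w : s → D.spec (Set.Icc (-1) 1) := fun l => ⟨v l, fun m hm =>
      D.incl_of_mem (hv l) (fun h => hm (h ▸ l.2.1))⟩
    have hw : LinearIndependent ℂ w := by
      refine LinearIndependent.of_comp (D.spec (Set.Icc (-1) 1)).subtype ?_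
      refine linearIndependent_of_ne_zero_of_inner_eq_zero hv0 (fun l m hlm => ?_)
      exact D.orthogonalFamily_eig (Subtype.coe_ne_coe.mpr hlm) ⟨v l, hv l⟩ ⟨v m, hv m⟩
    have := hw.finite
    exact Set.toFinite s
  -- Inserting 1 makes the finite set nonempty and accounts for the eigenvalues outside [-1, 1].
  have hs' : (insert 1 ((fun l => |l|) '' (s \ {0}))).Finite :=
    (hs.sdiff.image _).insert _
  obtain ⟨ε, hε, hmin⟩ := Set.exists_min_image _ id hs' ⟨1, Set.mem_insert _ _⟩
  refine ⟨ε, ?_, fun l hl hb => ?_⟩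
  · rcases hε with rfl | ⟨l, ⟨-, hl⟩, rfl⟩
    · exact one_pos
    · exact abs_pos.mpr hl
  · by_cases h : l ∈ Set.Icc (-1 : ℝ) 1
    · exact hmin |l| (Set.mem_insert_of_mem _ ⟨l, ⟨⟨h, hb⟩, hl⟩, rfl⟩)
    · have h1 : ε ≤ 1 := hmin 1 (Set.mem_insert _ _)
      have h2 : ¬ |l| ≤ 1 := fun h' => h (abs_le.mp h')
      linarith

/-- By the spectral gap, division by l is bounded off the kernel, so the range of A contains the
orthogonal complement of ker A. -/
theorem exists_graph_of_incl_zero (D : DiracSystem H) {y : H} (hy : D.incl y 0 = 0) :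
    ∃ x, (x, y) ∈ D.A.graph := by
  obtain ⟨ε, hε, hgap⟩ := D.exists_gap
  have hm : Memℓp (fun l : ℝ => ((l⁻¹ : ℝ) : ℂ) • D.incl y l) 2 := by
    refine Memℓp.mono' (g := fun l => ((ε⁻¹ : ℝ) : ℂ) • D.incl y l)
      ((D.memℓp_incl y).const_smul ((ε⁻¹ : ℝ) : ℂ)) (fun l => ?_)
    rcases eq_or_ne (D.incl y l) 0 with h0 | h0
    · simp [h0]
    have hl : l ≠ 0 := by rintro rfl; exact h0 hy
    have hb : D.eig l ≠ ⊥ := by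
      intro hb
      refine h0 (Subtype.ext ?_)
      exact (Submodule.mem_bot ℂ).mp (hb ▸ (D.incl y l).2)
    rw [norm_smul, norm_smul, Complex.norm_real, Complex.norm_real, norm_inv, norm_inv,
      Real.norm_eq_abs, Real.norm_of_nonneg hε.le]
    have := hgap l hl hb
    gcongr
  obtain ⟨x, hx⟩ := D.exists_incl_eq hm
  refine ⟨x, (D.mem_graph_iff_incl x y).mpr (fun l => ?_)⟩
  rw [hx, smul_smul]
  rcases eq_or_ne l 0 with rfl | hl
  · simp [hy]
  · rw [← Complex.ofReal_mul, mul_inv_cancel₀ hl, Complex.ofReal_one, one_smul]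

/-! ### The operator A⁺ and its index -/

theorem mem_Hplus (D : DiracSystem H) (x : H) : x ∈ D.Hplus ↔ Complex.I • D.γ x = x := Iff.rfl

theorem mem_Hminus (D : DiracSystem H) (x : H) : x ∈ D.Hminus ↔ Complex.I • D.γ x = -x := Iff.rfl

theorem γ_graph (D : DiracSystem H) {x y : H} (h : (x, y) ∈ D.A.graph) :
    (D.γ x, -D.γ y) ∈ D.A.graph := by
  rw [LinearPMap.mem_graph_iff] at h ⊢
  obtain ⟨a, ha, hy⟩ := h
  obtain ⟨h', e⟩ := D.anticomm a
  have ha' : (a : H) = x := ha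
  refine ⟨⟨_, h'⟩, ?_, ?_⟩
  · simp [ha']
  · have hy' : D.A a = y := hy
    rw [e, hy']

theorem I_γ_I_γ (D : DiracSystem H) (x : H) :
    Complex.I • D.γ (Complex.I • D.γ x) = x := by
  rw [map_smul, D.γ_γ, smul_smul, Complex.I_mul_I, neg_one_smul, neg_neg]

/-- The projection of `H` onto `H^+`. -/
def projPlus (D : DiracSystem H) (x : H) : D.Hplus :=
  ⟨(1 / 2 : ℂ) • (x + Complex.I • D.γ x), by
    rw [mem_Hplus, map_smul, smul_comm, map_add, smul_add, I_γ_I_γ, add_comm]⟩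

theorem projPlus_of_mem (D : DiracSystem H) (x : D.Hplus) : D.projPlus x = x := by
  have hx : Complex.I • D.γ (x : H) = x := x.2
  refine Subtype.ext ?_
  change (1 / 2 : ℂ) • ((x : H) + Complex.I • D.γ (x : H)) = x
  rw [hx, ← two_smul ℂ, smul_smul]
  norm_num

/-- Anticommutation gives A (1 + iγ) = (1 - iγ) A, so A intertwines the projections onto H⁺ and H⁻.
-/
theorem projPlus_graph (D : DiracSystem H) {x y : H} (h : (x, y) ∈ D.A.graph) :
    ((D.projPlus x : H), (1 / 2 : ℂ) • (y - Complex.I • D.γ y)) ∈ D.A.graph := by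
  have := D.A.graph.smul_mem (1 / 2 : ℂ)
    (D.A.graph.add_mem h (D.A.graph.smul_mem Complex.I (D.γ_graph h)))
  convert this using 1
  refine Prod.ext rfl ?_
  simp [sub_eq_add_neg]

theorem mem_Aplus_graph (D : DiracSystem H) (x : D.Hplus) (y : D.Hminus) :
    (x, y) ∈ D.Aplus.graph ↔ ((x : H), (y : H)) ∈ D.A.graph := by
  rw [LinearPMap.mem_graph_iff, LinearPMap.mem_graph_iff]
  constructor
  · rintro ⟨a, rfl, rfl⟩
    exact ⟨⟨((a : D.Hplus) : H), a.2⟩, rfl, rfl⟩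
  · rintro ⟨a, ha, hy⟩
    have ha' : (a : H) = x := ha
    refine ⟨⟨x, ?_⟩, rfl, ?_⟩
    · change (x : H) ∈ D.A.domain
      rw [← ha']; exact a.2
    · refine Subtype.ext ?_
      exact (congrArg D.A (Subtype.ext ha'.symm)).trans hy

/-- A preimage under A may be projected to H⁺: its image is then projected to H⁻, where y already
lies. -/
theorem mem_range_Aplus (D : DiracSystem H) (y : D.Hminus) :
    y ∈ LinearMap.range D.Aplus.toFun ↔ D.incl (y : H) 0 = 0 := by
  constructor
  · rintro ⟨x, rfl⟩
    have h := (D.mem_Aplus_graph x (D.Aplus x)).mp (LinearPMap.mem_graph _ _)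
    have := (D.mem_graph_iff_incl _ _).mp h 0
    simpa using this
  · intro h
    obtain ⟨x, hx⟩ := D.exists_graph_of_incl_zero h
    have h2 := D.projPlus_graph hx
    have hy : Complex.I • D.γ (y : H) = -y := y.2
    rw [hy, sub_neg_eq_add, ← two_smul ℂ, smul_smul, div_mul_cancel₀ _ two_ne_zero, one_smul,
      ← mem_Aplus_graph, LinearPMap.mem_graph_iff] at h2
    obtain ⟨a, -, ha⟩ := h2
    exact ⟨a, ha⟩

theorem map_ker_Aplus (D : DiracSystem H) :
    (LinearMap.ker D.Aplus.toFun).map (D.Hplus.subtype ∘ₗ D.Aplus.domain.subtype) =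
      D.eig 0 ⊓ D.Hplus := by
  ext x
  constructor
  · rintro ⟨a, ha, rfl⟩
    refine ⟨?_, (a : D.Hplus).2⟩
    have h := (D.mem_Aplus_graph a (D.Aplus a)).mp (LinearPMap.mem_graph _ _)
    have h0 : D.Aplus a = 0 := ha
    rw [SetLike.mem_coe, mem_eig_iff_graph]
    simpa [h0] using h
  · rintro ⟨h0, hx⟩
    rw [SetLike.mem_coe, mem_eig_iff_graph] at h0
    have h := (D.mem_Aplus_graph ⟨x, hx⟩ 0).mpr (by simpa using h0)
    obtain ⟨a, ha, ha'⟩ := (LinearPMap.mem_graph_iff _).mp h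
    exact ⟨a, ha', congrArg Subtype.val ha⟩

theorem injective_domain_Aplus (D : DiracSystem H) :
    Function.Injective (D.Hplus.subtype ∘ₗ D.Aplus.domain.subtype) :=
  Subtype.val_injective.comp Subtype.val_injective

/-- The kernel of `A^+` is `ker A ∩ H^+`. -/
def kerAplusEquiv (D : DiracSystem H) :
    LinearMap.ker D.Aplus.toFun ≃ₗ[ℂ] ↥(D.eig 0 ⊓ D.Hplus) :=
  (Submodule.equivMapOfInjective _ D.injective_domain_Aplus _).trans
    (LinearEquiv.ofEq _ _ D.map_ker_Aplus)

theorem incl_zero_mem_Hminus (D : DiracSystem H) {y : H} (hy : y ∈ D.Hminus) :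
    (D.incl y 0 : H) ∈ D.Hminus := by
  rw [mem_Hminus] at hy ⊢
  have h := D.coe_incl_γ y 0
  rw [neg_zero] at h
  have h2 : D.incl (Complex.I • D.γ y) 0 = D.incl (-y) 0 := by rw [hy]
  have h3 := congrArg (Subtype.val) h2
  rw [← h]
  simpa using h3

/-- The component in `ker A` of an element of `H^-`. -/
def kerPartMinus (D : DiracSystem H) : D.Hminus →ₗ[ℂ] ↥(D.eig 0 ⊓ D.Hminus) where
  toFun y := ⟨D.incl (y : H) 0, (D.incl (y : H) 0).2, D.incl_zero_mem_Hminus y.2⟩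
  map_add' x y := by ext; simp
  map_smul' c x := by ext; simp

/-- The cokernel of `A^+` is `ker A ∩ H^-`. -/
def cokerAplusEquiv (D : DiracSystem H) :
    (D.Hminus ⧸ LinearMap.range D.Aplus.toFun) ≃ₗ[ℂ] ↥(D.eig 0 ⊓ D.Hminus) :=
  (Submodule.quotEquivOfEq _ (LinearMap.ker D.kerPartMinus) (by
    ext y
    rw [mem_range_Aplus, LinearMap.mem_ker, kerPartMinus]
    simp only [LinearMap.coe_mk, AddHom.coe_mk, Subtype.ext_iff]
    rfl)).trans (D.kerPartMinus.quotKerEquivOfSurjective (fun x =>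
      ⟨⟨x, x.2.2⟩, Subtype.ext (D.coe_incl_of_mem x.2.1)⟩))

/-- Finiteness comes from dim ker A < ∞, and the range is closed as the zero set of the kernel
component. The domain is dense because it contains the projection of the dense subspace dom A. -/
theorem fredholm_Aplus (D : DiracSystem H) : UnboundedFredholm D.Aplus where
  closed := by
    have hA : IsClosed (D.A.graph : Set (H × H)) := D.selfAdjoint.isClosed
    have : (D.Aplus.graph : Set (D.Hplus × D.Hminus)) =
        (fun p : D.Hplus × D.Hminus => ((p.1 : H), (p.2 : H))) ⁻¹' D.A.graph := by
      ext ⟨x, y⟩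
      exact D.mem_Aplus_graph x y
    change IsClosed (D.Aplus.graph : Set (D.Hplus × D.Hminus))
    rw [this]
    exact hA.preimage (by fun_prop)
  dense := by
    have hs : Function.Surjective D.projPlus := fun x => ⟨x, D.projPlus_of_mem x⟩
    have hc : Continuous D.projPlus := by
      unfold projPlus
      fun_prop
    refine (hs.denseRange.dense_image hc D.selfAdjoint.dense_domain).mono ?_
    rintro _ ⟨x, hx, rfl⟩
    have h := D.projPlus_graph (LinearPMap.mem_graph D.A ⟨x, hx⟩)
    obtain ⟨a, ha, -⟩ := (LinearPMap.mem_graph_iff _).mp h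
    change (D.projPlus x : H) ∈ D.A.domain
    have ha' : (a : H) = D.projPlus x := ha
    rw [← ha']
    exact a.2
  finite_ker := by
    have := Submodule.finiteDimensional_inf_left (D.eig 0) D.Hplus
    exact LinearEquiv.finiteDimensional D.kerAplusEquiv.symm
  closed_range := by
    have : (LinearMap.range D.Aplus.toFun : Set D.Hminus) =
        (fun y : D.Hminus => D.incl (y : H) 0) ⁻¹' {0} := by
      ext y
      exact D.mem_range_Aplus y
    rw [this]
    exact isClosed_singleton.preimage ((D.continuous_incl_apply 0).comp continuous_subtype_val)
  finite_coker := by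
    have := Submodule.finiteDimensional_inf_left (D.eig 0) D.Hminus
    exact LinearEquiv.finiteDimensional D.cokerAplusEquiv.symm

theorem isHermitianSymplectic_iff_finrank (D : DiracSystem H) : D.IsHermitianSymplectic ↔
    Module.finrank ℂ ↥(D.eig 0 ⊓ D.Hplus) = Module.finrank ℂ ↥(D.eig 0 ⊓ D.Hminus) := by
  have := Submodule.finiteDimensional_inf_left (D.eig 0) D.Hplus
  have := Submodule.finiteDimensional_inf_left (D.eig 0) D.Hminus
  rw [IsHermitianSymplectic, ← Module.finrank_eq_rank, ← Module.finrank_eq_rank, Nat.cast_inj]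

theorem isHermitianSymplectic_iff_index (D : DiracSystem H) :
    D.IsHermitianSymplectic ↔ unboundedIndex D.Aplus = 0 := by
  rw [isHermitianSymplectic_iff_finrank, unboundedIndex, D.kerAplusEquiv.finrank_eq,
    D.cokerAplusEquiv.finrank_eq, sub_eq_zero, Nat.cast_inj]

/-! ### Lagrangian subspaces of ker A -/

theorem IsLagrangian.inner_γ {D : DiracSystem H} {L : Submodule ℂ H} (hL : D.IsLagrangian L)
    {x y : H} (hx : x ∈ L) (hy : y ∈ L) : inner ℂ x (D.γ y) = 0 :=
  Submodule.isOrtho_iff_inner_eq.mp hL.1 x hx _ (Submodule.mem_map_of_mem hy)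

theorem IsLagrangian.le {D : DiracSystem H} {L : Submodule ℂ H} (hL : D.IsLagrangian L) :
    L ≤ D.eig 0 := by
  rw [← hL.2]
  exact le_sup_left

theorem IsLagrangian.exists_add {D : DiracSystem H} {L : Submodule ℂ H} (hL : D.IsLagrangian L)
    {x : H} (hx : x ∈ D.eig 0) : ∃ a ∈ L, ∃ b ∈ L, a + D.γ b = x := by
  rw [← hL.2] at hx
  obtain ⟨a, ha, c, ⟨b, hb, rfl⟩, rfl⟩ := Submodule.mem_sup.mp hx
  exact ⟨a, ha, b, hb, rfl⟩

/-- The map x ↦ x + σ iγ x is an isomorphism from L onto the σ-eigenspace of iγ in ker A: injective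
since L ⟂ γ L, surjective since L + γ L = ker A. It is used for σ = 1 and σ = -1. -/
theorem IsLagrangian.rank_eq {D : DiracSystem H} {L : Submodule ℂ H} (hL : D.IsLagrangian L)
    {σ : ℂ} (hσ : σ * σ = 1) {E : Submodule ℂ H}
    (hE : ∀ x, x ∈ E ↔ x ∈ D.eig 0 ∧ Complex.I • D.γ x = σ • x) :
    Module.rank ℂ L = Module.rank ℂ E := by
  have hI : Complex.I * Complex.I = -1 := Complex.I_mul_I
  let f : L →ₗ[ℂ] H := L.subtype + (σ * Complex.I) • (D.γ.toLinearMap ∘ₗ L.subtype)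
  have hf (x : L) : f x = (x : H) + (σ * Complex.I) • D.γ (x : H) := rfl
  have hinj : Function.Injective f := by
    rw [injective_iff_map_eq_zero]
    intro x hx
    have h : inner ℂ (x : H) (f x) = 0 := by rw [hx, inner_zero_right]
    rw [hf, inner_add_right, inner_smul_right, hL.inner_γ x.2 x.2, mul_zero, add_zero,
      inner_self_eq_zero] at h
    exact Subtype.ext h
  have hrange : LinearMap.range f = E := by
    ext x
    rw [hE]
    constructor
    · rintro ⟨a, rfl⟩
      have ha := hL.le a.2
      refine ⟨(D.eig 0).add_mem ha ((D.eig 0).smul_mem _ (D.γ_mem_eig_zero ha)), ?_⟩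
      rw [hf, map_add, map_smul, D.γ_γ]
      simp only [smul_add, smul_smul, smul_neg]
      rw [← mul_assoc σ σ, hσ, one_mul, ← mul_assoc, mul_comm Complex.I σ, mul_assoc, hI]
      simp [add_comm]
    · rintro ⟨hx, hγ⟩
      obtain ⟨a, ha, b, hb, rfl⟩ := hL.exists_add hx
      -- An eigenvector is half its image under 1 + σ iγ, and this operator takes the same value on
      -- γ b and on -σ i b.
      refine ⟨⟨(1 / 2 : ℂ) • (a - (σ * Complex.I) • b), ?_⟩, ?_⟩
      · exact L.smul_mem _ (L.sub_mem ha (L.smul_mem _ hb))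
      · rw [hf]
        have h1 : (a + D.γ b) = σ • (Complex.I • D.γ (a + D.γ b)) := by
          rw [hγ, smul_smul, hσ, one_smul]
        rw [map_add, D.γ_γ] at h1
        simp only [map_smul, map_sub]
        have h2 : (σ * Complex.I) * (σ * Complex.I) = -1 := by
          linear_combination (Complex.I * Complex.I) * hσ + hI
        have h3 : a + D.γ b = (1 / 2 : ℂ) • ((a + D.γ b) + σ • (Complex.I • (D.γ a + -b))) := by
          rw [← h1, ← two_smul ℂ, smul_smul]; norm_num
        rw [h3]
        simp only [smul_add, smul_sub, smul_smul, smul_neg]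
        rw [show σ * Complex.I * (1 / 2 * (σ * Complex.I)) = -(1 / 2) by
          linear_combination (1 / 2 : ℂ) * h2, mul_comm (σ * Complex.I) (1 / 2), neg_smul]
        abel
  rw [← hrange]
  exact (LinearEquiv.ofInjective f hinj).rank_eq

theorem IsLagrangian.isHermitianSymplectic {D : DiracSystem H} {L : Submodule ℂ H}
    (hL : D.IsLagrangian L) : D.IsHermitianSymplectic := by
  have h1 := hL.rank_eq (σ := 1) (by ring) (E := D.eig 0 ⊓ D.Hplus)
    (fun x => by rw [Submodule.mem_inf, mem_Hplus, one_smul])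
  have h2 := hL.rank_eq (σ := -1) (by ring) (E := D.eig 0 ⊓ D.Hminus)
    (fun x => by rw [Submodule.mem_inf, mem_Hminus, neg_one_smul])
  exact h1.symm.trans h2

theorem γ_of_mem_Hplus (D : DiracSystem H) {x : H} (hx : x ∈ D.Hplus) :
    D.γ x = -(Complex.I • x) := by
  rw [mem_Hplus] at hx
  conv_rhs => rw [← hx]
  rw [smul_smul, Complex.I_mul_I, neg_one_smul, neg_neg]

theorem γ_of_mem_Hminus (D : DiracSystem H) {x : H} (hx : x ∈ D.Hminus) :
    D.γ x = Complex.I • x := by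
  rw [mem_Hminus] at hx
  rw [← neg_neg (Complex.I • x), ← smul_neg, ← hx, smul_smul, Complex.I_mul_I, neg_one_smul,
    neg_neg]

theorem inner_Hplus_Hminus (D : DiracSystem H) {x y : H} (hx : x ∈ D.Hplus)
    (hy : y ∈ D.Hminus) : inner ℂ x y = 0 := by
  have h := D.inner_γ_γ x y
  rw [D.γ_of_mem_Hplus hx, D.γ_of_mem_Hminus hy, inner_neg_left, inner_smul_left,
    inner_smul_right, Complex.conj_I] at h
  have : (2 : ℂ) * inner ℂ x y = 0 := by
    linear_combination -h + inner ℂ x y * Complex.I_mul_I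
  simpa using this

/-- Take the graph of a unitary U between the eigenspaces of iγ. As γ (x + U x) = i (U x - x),
isometry gives L ⟂ γ L, while sums and differences recover x and U x. -/
theorem IsHermitianSymplectic.exists_isLagrangian {D : DiracSystem H}
    (h : D.IsHermitianSymplectic) : ∃ L, D.IsLagrangian L := by
  rw [isHermitianSymplectic_iff_finrank] at h
  have := Submodule.finiteDimensional_inf_left (D.eig 0) D.Hplus
  have := Submodule.finiteDimensional_inf_left (D.eig 0) D.Hminus
  let U : ↥(D.eig 0 ⊓ D.Hplus) ≃ₗᵢ[ℂ] ↥(D.eig 0 ⊓ D.Hminus) :=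
    (stdOrthonormalBasis ℂ _).equiv (stdOrthonormalBasis ℂ _) (finCongr h)
  have hU (x y : ↥(D.eig 0 ⊓ D.Hplus)) : inner ℂ (U x : H) (U y : H) = inner ℂ (x : H) (y : H) :=
    U.inner_map_map x y
  have hγU (x : ↥(D.eig 0 ⊓ D.Hplus)) :
      D.γ ((x : H) + U x) = Complex.I • ((U x : H) - x) := by
    rw [map_add, D.γ_of_mem_Hplus x.2.2, D.γ_of_mem_Hminus (U x).2.2, smul_sub]
    abel
  let f : ↥(D.eig 0 ⊓ D.Hplus) →ₗ[ℂ] H :=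
    (D.eig 0 ⊓ D.Hplus).subtype + (D.eig 0 ⊓ D.Hminus).subtype ∘ₗ U.toLinearEquiv.toLinearMap
  have hf (x : ↥(D.eig 0 ⊓ D.Hplus)) : f x = (x : H) + U x := rfl
  have hfe (x : ↥(D.eig 0 ⊓ D.Hplus)) : f x ∈ D.eig 0 :=
    (D.eig 0).add_mem x.2.1 (U x).2.1
  refine ⟨LinearMap.range f, ?_, le_antisymm ?_ ?_⟩
  · rw [Submodule.isOrtho_iff_inner_eq]
    rintro _ ⟨x, rfl⟩ _ ⟨_, ⟨y, rfl⟩, rfl⟩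
    change inner ℂ (f x) (D.γ (f y)) = 0
    rw [hf, hf, hγU, inner_smul_right, inner_add_left, inner_sub_right, inner_sub_right, hU,
      D.inner_Hplus_Hminus x.2.2 (U y).2.2, ← inner_conj_symm (U x : H) (y : H),
      D.inner_Hplus_Hminus y.2.2 (U x).2.2]
    simp
  · refine sup_le ?_ ?_
    · rintro _ ⟨x, rfl⟩
      exact hfe x
    · rintro _ ⟨_, ⟨x, rfl⟩, rfl⟩
      exact D.γ_mem_eig_zero (hfe x)
  · intro x hx
    have hsplit : x = (1 / 2 : ℂ) • (x + Complex.I • D.γ x) +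
        (1 / 2 : ℂ) • (x - Complex.I • D.γ x) := by
      rw [← smul_add, add_add_sub_cancel, ← two_smul ℂ, smul_smul]; norm_num
    have hγx := (D.eig 0).smul_mem Complex.I (D.γ_mem_eig_zero hx)
    have hp : (1 / 2 : ℂ) • (x + Complex.I • D.γ x) ∈ D.eig 0 ⊓ D.Hplus :=
      ⟨(D.eig 0).smul_mem _ ((D.eig 0).add_mem hx hγx), (D.projPlus x).2⟩
    have hm : (1 / 2 : ℂ) • (x - Complex.I • D.γ x) ∈ D.eig 0 ⊓ D.Hminus := by
      refine ⟨(D.eig 0).smul_mem _ ((D.eig 0).sub_mem hx hγx), ?_⟩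
      rw [SetLike.mem_coe, mem_Hminus, map_smul, smul_comm, map_sub, smul_sub, I_γ_I_γ, ← smul_neg, neg_sub]
    rw [hsplit]
    have hIγ (a : ↥(D.eig 0 ⊓ D.Hplus)) : Complex.I • D.γ (f a) = (a : H) - U a := by
      rw [hf, hγU, smul_smul, Complex.I_mul_I, neg_one_smul, neg_sub]
    have h1 (a : ↥(D.eig 0 ⊓ D.Hplus)) (c : ℂ) : (1 / 2 : ℂ) • (f a + c • Complex.I • D.γ (f a)) ∈
        LinearMap.range f ⊔ (LinearMap.range f).map D.γ.toLinearMap := by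
      refine Submodule.smul_mem _ _ (Submodule.add_mem_sup ⟨a, rfl⟩ ?_)
      exact Submodule.smul_mem _ _ (Submodule.smul_mem _ _ (Submodule.mem_map_of_mem ⟨a, rfl⟩))
    refine Submodule.add_mem _ ?_ ?_
    · have := h1 ⟨_, hp⟩ 1
      rw [hIγ, hf, one_smul, add_add_sub_cancel, ← two_smul ℂ, smul_smul] at this
      norm_num at this
      simpa using this
    · have := h1 (U.symm ⟨_, hm⟩) (-1)
      rw [hIγ, hf, U.apply_symm_apply, neg_one_smul, neg_sub, show ∀ p q : H, p + q + (q - p) = q + q by intros; abel,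
        ← two_smul ℂ, smul_smul] at this
      norm_num at this
      simpa using this

/-! ### Weights, diagonal operators and spectral projections -/

theorem weight_mul (s t l : ℝ) : weight s l * weight t l = weight (s + t) l := by
  have h : (0 : ℝ) < 1 + l ^ 2 := by positivity
  rw [weight, weight, weight, ← Complex.ofReal_mul, ← Real.rpow_add h, add_div]

theorem weight_zero_left (l : ℝ) : weight 0 l = 1 := by simp [weight]

theorem weight_zero_right (s : ℝ) : weight s 0 = 1 := by simp [weight]

theorem weight_neg_right (s l : ℝ) : weight s (-l) = weight s l := by simp [weight]

theorem conj_weight (s l : ℝ) : starRingEnd ℂ (weight s l) = weight s l := Complex.conj_ofReal _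

theorem weight_neg_mul (s l : ℝ) : weight (-s) l * weight s l = 1 := by
  rw [weight_mul, neg_add_cancel, weight_zero_left]

theorem weight_mul_neg (s l : ℝ) : weight s l * weight (-s) l = 1 := by
  rw [mul_comm, weight_neg_mul]

theorem weight_ne_zero (s l : ℝ) : weight s l ≠ 0 := left_ne_zero_of_mul_eq_one (weight_mul_neg s l)

theorem norm_weight_le_one {s : ℝ} (hs : s ≤ 0) (l : ℝ) : ‖weight s l‖ ≤ 1 := by
  have h : (1 : ℝ) ≤ 1 + l ^ 2 := by nlinarith [sq_nonneg l]
  rw [weight, Complex.norm_real, Real.norm_of_nonneg (by positivity)]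
  exact Real.rpow_le_one_of_one_le_of_nonpos h (by linarith)

theorem memℓp_smul_incl (D : DiracSystem H) {m : ℝ → ℂ} {M : ℝ} (hm : ∀ l, ‖m l‖ ≤ M) (x : H) :
    Memℓp (fun l => m l • D.incl x l) 2 := by
  have hM : 0 ≤ M := (norm_nonneg _).trans (hm 0)
  refine Memℓp.mono' (g := fun l => (M : ℂ) • D.incl x l)
    ((D.memℓp_incl x).const_smul (M : ℂ)) (fun l => ?_)
  rw [norm_smul, norm_smul, Complex.norm_real, Real.norm_of_nonneg hM]
  gcongr
  exact hm l

/-- The bounded operator acting on the eigenspace of `l` as multiplication by `m l`. -/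
def diag (D : DiracSystem H) (m : ℝ → ℂ) (M : ℝ) (hm : ∀ l, ‖m l‖ ≤ M) : H →L[ℂ] H :=
  LinearMap.mkContinuous
    { toFun := fun x => D.iso.symm ⟨fun l => m l • D.incl x l, D.memℓp_smul_incl hm x⟩
      map_add' := fun x y => by
        rw [← map_add]
        congr 1
        ext l : 2
        simp only [map_add, Pi.add_apply, smul_add]
        rfl
      map_smul' := fun c x => by
        rw [RingHom.id_apply, ← map_smul]
        congr 1
        ext l : 2
        simp [smul_comm c] } M (fun x => by
    have hM : 0 ≤ M := (norm_nonneg _).trans (hm 0)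
    refine (abs_le_of_sq_le_sq' ?_ (by positivity)).2
    rw [mul_pow]
    refine hasSum_le (fun l => ?_) (D.norm_sq_eq_tsum _) ((D.norm_sq_eq_tsum x).mul_left (M ^ 2))
    simp only [LinearMap.coe_mk, AddHom.coe_mk]
    rw [incl_iso_symm, ← mul_pow]
    change ‖m l • D.incl x l‖ ^ 2 ≤ _
    rw [norm_smul]
    gcongr
    exact hm l)

theorem incl_diag (D : DiracSystem H) (m : ℝ → ℂ) (M : ℝ) (hm : ∀ l, ‖m l‖ ≤ M) (x : H) (l : ℝ) :
    D.incl (D.diag m M hm x) l = m l • D.incl x l :=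
  congrFun (D.incl_iso_symm _) l

theorem norm_diag_le (D : DiracSystem H) (m : ℝ → ℂ) (M : ℝ) (hm : ∀ l, ‖m l‖ ≤ M) (x : H) :
    ‖D.diag m M hm x‖ ≤ M * ‖x‖ :=
  ContinuousLinearMap.le_of_opNorm_le _
    (LinearMap.mkContinuous_norm_le _ ((norm_nonneg _).trans (hm 0)) _) x

theorem ext_incl (D : DiracSystem H) {x y : H} (h : ∀ l, D.incl x l = D.incl y l) : x = y :=
  D.incl_injective (funext h)

open Classical in
theorem norm_indicator_le (J : Set ℝ) (l : ℝ) : ‖(if l ∈ J then 1 else 0 : ℂ)‖ ≤ 1 := by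
  split_ifs <;> simp

open Classical in
/-- The spectral projection of `A` for the set `J`, on `H`. -/
def proj (D : DiracSystem H) (J : Set ℝ) : H →L[ℂ] H :=
  D.diag (fun l => if l ∈ J then 1 else 0) 1 (norm_indicator_le J)

theorem incl_proj_of_mem (D : DiracSystem H) {J : Set ℝ} {l : ℝ} (hl : l ∈ J) (x : H) :
    D.incl (D.proj J x) l = D.incl x l := by
  simp [proj, incl_diag, hl]

theorem incl_proj_of_notMem (D : DiracSystem H) {J : Set ℝ} {l : ℝ} (hl : l ∉ J) (x : H) :
    D.incl (D.proj J x) l = 0 := by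
  simp [proj, incl_diag, hl]

theorem Q_of_mem (D : DiracSystem H) {J : Set ℝ} {l : ℝ} (hl : l ∈ J) (x : D.Formal) :
    D.Q J x l = x l := by
  simp [Q, hl]

theorem Q_of_notMem (D : DiracSystem H) {J : Set ℝ} {l : ℝ} (hl : l ∉ J) (x : D.Formal) :
    D.Q J x l = 0 := by
  simp [Q, hl]

theorem proj_mem_spec (D : DiracSystem H) (J : Set ℝ) (x : H) : D.proj J x ∈ D.spec J :=
  fun _ hl => D.incl_proj_of_notMem hl x

theorem proj_of_mem (D : DiracSystem H) {J : Set ℝ} {x : H} (hx : x ∈ D.spec J) :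
    D.proj J x = x := by
  refine D.ext_incl (fun l => ?_)
  by_cases hl : l ∈ J
  · rw [incl_proj_of_mem D hl]
  · rw [incl_proj_of_notMem D hl, hx l hl]

theorem proj_of_disjoint (D : DiracSystem H) {J K : Set ℝ} (h : Disjoint J K) {x : H}
    (hx : x ∈ D.spec K) : D.proj J x = 0 := by
  refine D.ext_incl (fun l => ?_)
  rw [map_zero, Pi.zero_apply]
  by_cases hl : l ∈ J
  · rw [incl_proj_of_mem D hl, hx l (h.notMem_of_mem_left hl)]
  · rw [incl_proj_of_notMem D hl]

theorem proj_union (D : DiracSystem H) {J K : Set ℝ} (h : Disjoint J K) (x : H) :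
    D.proj (J ∪ K) x = D.proj J x + D.proj K x := by
  refine D.ext_incl (fun l => ?_)
  rw [map_add, Pi.add_apply]
  by_cases hJ : l ∈ J
  · have hK := h.notMem_of_mem_left hJ
    rw [incl_proj_of_mem D (Or.inl hJ), incl_proj_of_mem D hJ, incl_proj_of_notMem D hK, add_zero]
  · by_cases hK : l ∈ K
    · rw [incl_proj_of_mem D (Or.inr hK), incl_proj_of_mem D hK, incl_proj_of_notMem D hJ, zero_add]
    · rw [incl_proj_of_notMem D hK, incl_proj_of_notMem D hJ, incl_proj_of_notMem D
        (by simp [hJ, hK]), add_zero]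

theorem spec_mono (D : DiracSystem H) {J K : Set ℝ} (h : J ⊆ K) : D.spec J ≤ D.spec K :=
  fun _ hx l hl => hx l (fun h' => hl (h h'))

theorem inner_spec_of_disjoint (D : DiracSystem H) {J K : Set ℝ} (h : Disjoint J K) {x y : H}
    (hx : x ∈ D.spec J) (hy : y ∈ D.spec K) : inner ℂ x y = 0 := by
  refine (D.hasSum_inner_incl x y).unique ?_
  convert hasSum_zero with l
  by_cases hl : l ∈ J
  · rw [hy l (h.notMem_of_mem_left hl), inner_zero_right]
  · rw [hx l hl, inner_zero_left]

theorem incl_γ_eq_zero_iff (D : DiracSystem H) (x : H) (l : ℝ) :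
    D.incl (D.γ x) l = 0 ↔ D.incl x (-l) = 0 := by
  rw [Subtype.ext_iff, coe_incl_γ, ZeroMemClass.coe_zero, ← norm_eq_zero, D.norm_γ, norm_eq_zero,
    Subtype.ext_iff, ZeroMemClass.coe_zero]

theorem γ_mem_spec (D : DiracSystem H) {J K : Set ℝ} (h : ∀ l ∈ J, -l ∈ K) {x : H}
    (hx : x ∈ D.spec J) : D.γ x ∈ D.spec K := by
  intro l hl
  rw [incl_γ_eq_zero_iff]
  exact hx _ (fun h' => hl (by simpa using h _ h'))

theorem eig_zero_eq_spec (D : DiracSystem H) : D.eig 0 = D.spec {0} := by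
  ext x
  exact D.mem_eig_iff_incl 0 x

theorem eig_le_spec (D : DiracSystem H) {l : ℝ} {J : Set ℝ} (h : l ∈ J) : D.eig l ≤ D.spec J := by
  intro x hx m hm
  exact D.incl_of_mem hx (fun e => hm (e ▸ h))

/-- The closed span is a double orthogonal complement. A vector orthogonal to all negative
eigenspaces has no negative components, so Parseval makes it orthogonal to the spectral subspace. -/
theorem Hneg_eq_spec (D : DiracSystem H) : D.Hneg = D.spec (Set.Iio 0) := by
  refine le_antisymm ?_ (fun x hx => ?_)
  · refine Submodule.topologicalClosure_minimal _ (iSup₂_le fun l hl => ?_) (D.isClosed_spec _)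
    exact D.eig_le_spec hl
  · rw [Hneg, ← Submodule.orthogonal_orthogonal_eq_closure, Submodule.mem_orthogonal]
    intro z hz
    refine (D.hasSum_inner_incl z x).unique ?_
    convert hasSum_zero with l
    by_cases hl : l ∈ Set.Iio (0 : ℝ)
    · have : D.incl z l = 0 := by
        refine ext_inner_left ℂ (fun v => ?_)
        rw [Submodule.coe_inner, inner_coe_incl _ v.2, inner_zero_right]
        refine (Submodule.mem_orthogonal _ _).mp hz v ?_
        exact Submodule.mem_iSup_of_mem l (Submodule.mem_iSup_of_mem hl v.2)
      rw [this, inner_zero_left]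
    · rw [hx l hl, inner_zero_right]

/-! ### The space H^{1/2} inside H -/

theorem mem_Hhalf (D : DiracSystem H) (x : H) : x ∈ D.Hhalf ↔ D.incl x ∈ D.sobolev (1 / 2) :=
  Iff.rfl

theorem mem_Hhalf_iff (D : DiracSystem H) (x : H) :
    x ∈ D.Hhalf ↔ ∃ p, ∀ l, D.incl p l = weight (1 / 2) l • D.incl x l := by
  constructor
  · intro h
    obtain ⟨p, hp⟩ := D.exists_incl_eq (x := fun l => weight (1 / 2) l • D.incl x l) h
    exact ⟨p, fun l => congrFun hp l⟩
  · rintro ⟨p, hp⟩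
    change Memℓp (fun l => weight (1 / 2) l • D.incl x l) 2
    rw [← funext hp]
    exact D.memℓp_incl p

/-- The embedding `(I + A²)^(-1/4)` of `H` onto `H^{1/2}`. -/
def halfEmb (D : DiracSystem H) : H →L[ℂ] H :=
  D.diag (weight (-(1 / 2))) 1 (norm_weight_le_one (by norm_num))

theorem incl_halfEmb (D : DiracSystem H) (x : H) (l : ℝ) :
    D.incl (D.halfEmb x) l = weight (-(1 / 2)) l • D.incl x l :=
  D.incl_diag _ _ _ x l

theorem halfEmb_mem (D : DiracSystem H) (x : H) : D.halfEmb x ∈ D.Hhalf := by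
  rw [mem_Hhalf_iff]
  refine ⟨x, fun l => ?_⟩
  rw [incl_halfEmb, smul_smul, weight_mul_neg, one_smul]

theorem exists_halfEmb (D : DiracSystem H) {x : H} (hx : x ∈ D.Hhalf) : ∃ p, D.halfEmb p = x := by
  obtain ⟨p, hp⟩ := (D.mem_Hhalf_iff x).mp hx
  refine ⟨p, D.ext_incl (fun l => ?_)⟩
  rw [incl_halfEmb, hp, smul_smul, weight_neg_mul, one_smul]

theorem halfEmb_injective (D : DiracSystem H) : Function.Injective D.halfEmb := by
  intro x y h
  refine D.ext_incl (fun l => ?_)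
  have := congrFun (congrArg D.incl h) l
  rw [incl_halfEmb, incl_halfEmb] at this
  exact smul_right_injective _ (weight_ne_zero _ _) this

theorem diag_mem_Hhalf (D : DiracSystem H) (m : ℝ → ℂ) (M : ℝ) (hm : ∀ l, ‖m l‖ ≤ M) {x : H}
    (hx : x ∈ D.Hhalf) : D.diag m M hm x ∈ D.Hhalf := by
  rw [mem_Hhalf_iff] at hx ⊢
  obtain ⟨p, hp⟩ := hx
  refine ⟨D.diag m M hm p, fun l => ?_⟩
  rw [incl_diag, incl_diag, hp, smul_comm]

theorem proj_mem_Hhalf (D : DiracSystem H) (J : Set ℝ) {x : H} (hx : x ∈ D.Hhalf) :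
    D.proj J x ∈ D.Hhalf :=
  D.diag_mem_Hhalf _ _ _ hx

theorem γ_mem_Hhalf (D : DiracSystem H) {x : H} (hx : x ∈ D.Hhalf) : D.γ x ∈ D.Hhalf := by
  rw [mem_Hhalf, incl_γ]
  exact D.γF_mem_sobolev _ hx

theorem eig_le_Hhalf (D : DiracSystem H) (l : ℝ) : D.eig l ≤ D.Hhalf := by
  intro x hx
  rw [mem_Hhalf_iff]
  refine ⟨weight (1 / 2) l • x, fun m => ?_⟩
  rcases eq_or_ne m l with rfl | hm
  · rw [map_smul, Pi.smul_apply]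
  · rw [map_smul, Pi.smul_apply, D.incl_of_mem hx hm.symm, smul_zero, smul_zero]

/-! ### Ȟ in the coordinates of H -/

/-- The eigenvalues of the isomorphism from `H` to `Ȟ`. -/
def checkWeight (l : ℝ) : ℂ := if l ≤ 0 then weight (-(1 / 2)) l else weight (1 / 2) l

theorem checkWeight_of_nonpos {l : ℝ} (hl : l ≤ 0) : checkWeight l = weight (-(1 / 2)) l :=
  if_pos hl

theorem checkWeight_of_pos {l : ℝ} (hl : 0 < l) : checkWeight l = weight (1 / 2) l :=
  if_neg hl.not_ge

theorem checkWeight_of_nonneg {l : ℝ} (hl : 0 ≤ l) : checkWeight l = weight (1 / 2) l := by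
  rcases hl.eq_or_lt with rfl | hl
  · rw [checkWeight_of_nonpos le_rfl, weight_zero_right, weight_zero_right]
  · exact checkWeight_of_pos hl

/-- This reciprocity makes the weights cancel in ω, since γ pairs l with -l. -/
theorem checkWeight_neg_mul (l : ℝ) : checkWeight (-l) * checkWeight l = 1 := by
  rcases le_total l 0 with hl | hl
  · rw [checkWeight_of_nonpos hl, checkWeight_of_nonneg (neg_nonneg.mpr hl), weight_neg_right,
      weight_mul_neg]
  · rw [checkWeight_of_nonneg hl, checkWeight_of_nonpos (neg_nonpos.mpr hl), weight_neg_right,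
      weight_neg_mul]

theorem conj_checkWeight (l : ℝ) : starRingEnd ℂ (checkWeight l) = checkWeight l := by
  unfold checkWeight
  split_ifs <;> exact conj_weight _ _

/-- The isomorphism from `H` to `Ȟ`. -/
def ofL2 (D : DiracSystem H) : H →ₗ[ℂ] D.Formal where
  toFun x l := checkWeight l • D.incl x l
  map_add' x y := by funext l; simp
  map_smul' c x := by funext l; simp [smul_comm c]

theorem ofL2_apply (D : DiracSystem H) (x : H) (l : ℝ) :
    D.ofL2 x l = checkWeight l • D.incl x l := rfl

theorem weight_smul_Q_ofL2 (D : DiracSystem H) (x : H) (l : ℝ) :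
    weight (1 / 2) l • D.Q (Set.Iic 0) (D.ofL2 x) l = D.incl (D.proj (Set.Iic 0) x) l := by
  by_cases hl : l ∈ Set.Iic (0 : ℝ)
  · rw [Q_of_mem D hl, ofL2_apply, incl_proj_of_mem D hl, checkWeight_of_nonpos hl, smul_smul,
      weight_mul_neg, one_smul]
  · rw [Q_of_notMem D hl, incl_proj_of_notMem D hl, smul_zero]

theorem weight_smul_Q_ofL2' (D : DiracSystem H) (x : H) (l : ℝ) :
    weight (-(1 / 2)) l • D.Q (Set.Ioi 0) (D.ofL2 x) l = D.incl (D.proj (Set.Ioi 0) x) l := by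
  by_cases hl : l ∈ Set.Ioi (0 : ℝ)
  · rw [Q_of_mem D hl, ofL2_apply, incl_proj_of_mem D hl, checkWeight_of_pos hl, smul_smul,
      weight_neg_mul, one_smul]
  · rw [Q_of_notMem D hl, incl_proj_of_notMem D hl, smul_zero]

theorem ofL2_mem_check (D : DiracSystem H) (x : H) : D.ofL2 x ∈ D.check := by
  rw [mem_check]
  constructor
  · change Memℓp (fun l => weight (1 / 2) l • D.Q (Set.Iic 0) (D.ofL2 x) l) 2
    rw [funext (D.weight_smul_Q_ofL2 x)]
    exact D.memℓp_incl _
  · change Memℓp (fun l => weight (-(1 / 2)) l • D.Q (Set.Ioi 0) (D.ofL2 x) l) 2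
    rw [funext (D.weight_smul_Q_ofL2' x)]
    exact D.memℓp_incl _

theorem checkEmb_ofL2 (D : DiracSystem H) (x : H) :
    D.checkEmb ⟨D.ofL2 x, D.ofL2_mem_check x⟩ =
      (D.iso (D.proj (Set.Iic 0) x), D.iso (D.proj (Set.Ioi 0) x)) := by
  refine Prod.ext (lp.ext (funext fun l => ?_)) (lp.ext (funext fun l => ?_))
  · exact (D.weight_smul_Q_ofL2 x l).trans (D.iso_apply _ l).symm
  · exact (D.weight_smul_Q_ofL2' x l).trans (D.iso_apply _ l).symm

/-- The inverse of the isomorphism from `H` to `Ȟ`. -/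
def toL2 (D : DiracSystem H) (x : D.check) : H :=
  D.iso.symm ((D.checkEmb x).1 + (D.checkEmb x).2)

theorem ofL2_toL2 (D : DiracSystem H) (x : D.check) : D.ofL2 (D.toL2 x) = x := by
  funext l
  rw [ofL2_apply, toL2, incl_iso_symm]
  change checkWeight l • (weight (1 / 2) l • D.Q (Set.Iic 0) x l +
    weight (-(1 / 2)) l • D.Q (Set.Ioi 0) x l) = _
  rcases le_or_gt l 0 with hl | hl
  · rw [Q_of_mem D (Set.mem_Iic.mpr hl), Q_of_notMem D (by simpa using hl), smul_zero, add_zero,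
      checkWeight_of_nonpos hl, smul_smul, weight_neg_mul, one_smul]
  · rw [Q_of_mem D (Set.mem_Ioi.mpr hl), Q_of_notMem D (by simpa using hl), smul_zero, zero_add,
      checkWeight_of_pos hl, smul_smul, weight_mul_neg, one_smul]

theorem exists_ofL2 (D : DiracSystem H) {x : D.Formal} (hx : x ∈ D.check) : ∃ r, D.ofL2 r = x :=
  ⟨_, D.ofL2_toL2 ⟨x, hx⟩⟩

/-- In these coordinates the embedding defining the topology of Ȟ is the pair of spectral
projections of H, so Ȟ is homeomorphic to H and closedness can be tested there. -/
theorem isBoundaryCondition_iff (D : DiracSystem H) (B : Submodule ℂ D.Formal) :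
    D.IsBoundaryCondition B ↔ B ≤ D.check ∧ IsClosed (B.comap D.ofL2 : Set H) := by
  refine and_congr_right (fun _ => ?_)
  let _ : TopologicalSpace D.check := D.checkTopology
  constructor
  · intro h
    have hc : Continuous (fun x : H => (⟨D.ofL2 x, D.ofL2_mem_check x⟩ : D.check)) := by
      refine continuous_induced_rng.mpr ?_
      change Continuous (fun x : H => D.checkEmb ⟨D.ofL2 x, D.ofL2_mem_check x⟩)
      simp only [checkEmb_ofL2]
      fun_prop
    exact IsClosed.preimage hc h
  · intro h
    have hc : Continuous D.toL2 := by
      have hi : Continuous D.checkEmb := continuous_induced_dom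
      exact D.iso.symm.continuous.comp ((continuous_fst.comp hi).add (continuous_snd.comp hi))
    convert IsClosed.preimage hc h using 1
    ext x
    simp [ofL2_toL2]

/-! ### The boundary form and annihilators -/

theorem pairing_eq (D : DiracSystem H) (s : ℝ) (x y : D.Formal) (l : ℝ) :
    inner ℂ (weight (-s) l • y l) (weight s l • x l) = inner ℂ (y l) (x l) := by
  rw [inner_smul_left, inner_smul_right, conj_weight, ← mul_assoc, weight_neg_mul, one_mul]

/-- The two pairings in ω live on complementary sets of eigenvalues, and their weights cancel,
leaving a single unweighted sum. -/
theorem hasSum_ω (D : DiracSystem H) {x y : D.Formal} (hx : x ∈ D.check) (hy : y ∈ D.check) :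
    HasSum (fun l => inner ℂ (D.γF y l) (x l)) (D.ω x y) := by
  have h1 := (D.summable_pairing (-(1 / 2)) ((D.mem_check x).mp hx).2
    (y := D.γF (D.Q (Set.Iio 0) y)) (by rw [neg_neg]; exact D.γF_mem_sobolev _ (D.Q_neg_mem hy))).hasSum
  have h2 := (D.summable_pairing (1 / 2) ((D.mem_check x).mp hx).1
    (D.γF_mem_sobolev _ (D.Q_nonneg_mem hy))).hasSum
  have h3 : HasSum _ (D.ω x y) := h1.add h2
  convert h3 using 1
  funext l
  rw [pairing_eq, pairing_eq]
  change inner ℂ (D.γ (y (-l)) : H) (x l : H) =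
    inner ℂ (D.γ (D.Q (Set.Iio 0) y (-l)) : H) (D.Q (Set.Ioi 0) x l : H) +
    inner ℂ (D.γ (D.Q (Set.Ici 0) y (-l)) : H) (D.Q (Set.Iic 0) x l : H)
  rcases le_or_gt l 0 with hl | hl
  · rw [Q_of_notMem D (J := Set.Ioi 0) (by simpa using hl), Q_of_mem D (J := Set.Iic 0) hl,
      Q_of_mem D (J := Set.Ici 0) (by simpa using hl)]
    simp
  · rw [Q_of_mem D (J := Set.Ioi 0) hl, Q_of_notMem D (J := Set.Iic 0) (by simpa using hl),
      Q_of_mem D (J := Set.Iio 0) (by simpa using hl)]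
    simp

/-- In the coordinates of H, ω is a bounded nondegenerate form, so orthogonality arguments in H
apply to annihilators. -/
theorem ω_ofL2 (D : DiracSystem H) (r s : H) :
    D.ω (D.ofL2 r) (D.ofL2 s) = inner ℂ (D.γ s) r := by
  refine (D.hasSum_ω (D.ofL2_mem_check r) (D.ofL2_mem_check s)).unique ?_
  convert D.hasSum_inner_incl (D.γ s) r using 2 with l
  rw [incl_γ, ofL2_apply, inner_smul_right, Submodule.coe_inner, Submodule.coe_inner]
  change checkWeight l * inner ℂ (D.γ (checkWeight (-l) • (D.incl s (-l) : H))) _ =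
    inner ℂ (D.γ (D.incl s (-l) : H)) _
  rw [map_smul, inner_smul_left, conj_checkWeight, ← mul_assoc, mul_comm (checkWeight l),
    checkWeight_neg_mul, one_mul]

theorem sobolev_half_le_check (D : DiracSystem H) : D.sobolev (1 / 2) ≤ D.check := by
  intro x hx
  rw [mem_check]
  exact ⟨D.Q_mem_sobolev _ _ hx, D.sobolev_anti (by norm_num) (D.Q_mem_sobolev _ _ hx)⟩

theorem exists_incl_of_sobolev (D : DiracSystem H) {x : D.Formal} (hx : x ∈ D.sobolev (1 / 2)) :
    ∃ a ∈ D.Hhalf, D.incl a = x := by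
  have h : x ∈ D.sobolev 0 := D.sobolev_anti (by norm_num) hx
  have h' : Memℓp (fun l => weight 0 l • x l) 2 := h
  simp only [weight_zero_left, one_smul] at h'
  obtain ⟨a, rfl⟩ := D.exists_incl_eq (x := x) h'
  exact ⟨a, hx, rfl⟩

theorem ω_incl (D : DiracSystem H) {x y : H} (hx : x ∈ D.Hhalf) (hy : y ∈ D.Hhalf) :
    D.ω (D.incl x) (D.incl y) = inner ℂ (D.γ y) x := by
  refine (D.hasSum_ω (D.sobolev_half_le_check hx) (D.sobolev_half_le_check hy)).unique ?_
  simpa only [incl_γ] using D.hasSum_inner_incl (D.γ y) x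

theorem ofL2_mem_annihilator (D : DiracSystem H) (B : Submodule ℂ D.Formal) (s : H) :
    D.ofL2 s ∈ D.annihilator B ↔ ∀ r, D.ofL2 r ∈ B → inner ℂ (D.γ s) r = 0 := by
  constructor
  · intro h r hr
    rw [← ω_ofL2]
    exact h.2 _ ⟨hr, D.ofL2_mem_check r⟩
  · intro h
    refine ⟨D.ofL2_mem_check s, fun x hx => ?_⟩
    obtain ⟨r, rfl⟩ := D.exists_ofL2 hx.2
    rw [ω_ofL2, h r hx.1]

theorem isBoundaryCondition_annihilator (D : DiracSystem H) (B : Submodule ℂ D.Formal) :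
    D.IsBoundaryCondition (D.annihilator B) := by
  rw [isBoundaryCondition_iff]
  refine ⟨fun x hx => hx.1, ?_⟩
  have : ((D.annihilator B).comap D.ofL2 : Set H) =
      ⋂ r, ⋂ (_ : D.ofL2 r ∈ B), (fun s => inner ℂ (D.γ s) r) ⁻¹' {0} := by
    ext s
    simp only [Submodule.comap_coe, Set.mem_preimage, SetLike.mem_coe, ofL2_mem_annihilator,
      Set.mem_iInter, Set.mem_singleton_iff]
  rw [this]
  exact isClosed_iInter (fun r => isClosed_iInter (fun _ =>
    isClosed_singleton.preimage (by fun_prop)))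

theorem ω_add_left (D : DiracSystem H) {x y z : D.Formal} (hx : x ∈ D.check)
    (hy : y ∈ D.check) (hz : z ∈ D.check) : D.ω (x + y) z = D.ω x z + D.ω y z := by
  refine (D.hasSum_ω (D.check.add_mem hx hy) hz).unique ?_
  simpa only [Pi.add_apply, inner_add_right] using (D.hasSum_ω hx hz).add (D.hasSum_ω hy hz)

theorem ω_smul_left (D : DiracSystem H) (c : ℂ) {x z : D.Formal} (hx : x ∈ D.check)
    (hz : z ∈ D.check) : D.ω (c • x) z = c * D.ω x z := by
  refine (D.hasSum_ω (D.check.smul_mem c hx) hz).unique ?_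
  simpa only [Pi.smul_apply, inner_smul_right] using (D.hasSum_ω hx hz).mul_left c

theorem Hhalf_check (D : DiracSystem H) {x : H} (hx : x ∈ D.Hhalf) : D.incl x ∈ D.check :=
  D.sobolev_half_le_check hx

theorem ω_eig (D : DiracSystem H) {l : ℝ} {x : H} (hx : x ∈ D.eig l) {z : D.Formal}
    (hz : z ∈ D.check) : D.ω (D.incl x) z = inner ℂ (D.γ (z (-l))) x := by
  refine (D.hasSum_ω (D.Hhalf_check (D.eig_le_Hhalf l hx)) hz).unique ?_
  convert hasSum_single l (fun m hm => ?_) using 1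
  · rw [Submodule.coe_inner, D.coe_incl_of_mem hx]
    rfl
  · rw [D.incl_of_mem hx hm.symm, inner_zero_right]

theorem ω_eq_zero_of_spec (D : DiracSystem H) {J : Set ℝ} {x : H} (hx : x ∈ D.Hhalf)
    (hxJ : x ∈ D.spec J) {z : D.Formal} (hz : z ∈ D.check) (hzJ : ∀ l ∈ J, z (-l) = 0) :
    D.ω (D.incl x) z = 0 := by
  refine (D.hasSum_ω (D.Hhalf_check hx) hz).unique ?_
  convert hasSum_zero with l
  by_cases hl : l ∈ J
  · have : D.γF z l = 0 := Subtype.ext (by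
      change D.γ (z (-l)) = 0
      rw [hzJ l hl]
      simp)
    rw [this, inner_zero_left]
  · rw [hxJ l hl, inner_zero_right]

/-- An element of `Ȟ` is the sum of an element of `H^{1/2}_{(-∞,0]}` and one supported on the
positive eigenvalues. -/
theorem exists_check_decomp (D : DiracSystem H) {y : D.Formal} (hy : y ∈ D.check) :
    ∃ a ∈ D.Hhalf ⊓ D.spec (Set.Iio 0), ∃ e ∈ D.eig 0, ∃ z ∈ D.check, (∀ l ≤ 0, z l = 0) ∧
      y = D.incl (a + e) + z := by
  obtain ⟨a, ha, ha'⟩ := D.exists_incl_of_sobolev (D.Q_neg_mem hy)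
  have haJ : a ∈ D.spec (Set.Iio 0) := fun l hl => by rw [ha', Q_of_notMem D hl]
  have hc : a + (y 0 : H) ∈ D.Hhalf := D.Hhalf.add_mem ha (D.eig_le_Hhalf 0 (y 0).2)
  refine ⟨a, ⟨ha, haJ⟩, y 0, (y 0).2, y - D.incl (a + (y 0 : H)),
    D.check.sub_mem hy (D.Hhalf_check hc), fun l hl => ?_, by abel⟩
  rw [map_add, Pi.sub_apply, Pi.add_apply]
  rcases hl.eq_or_lt with rfl | hl
  · rw [haJ 0 (by simp), zero_add, sub_eq_zero]
    exact Subtype.ext (D.coe_incl_of_mem (y 0).2).symm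
  · rw [ha', Q_of_mem D (Set.mem_Iio.mpr hl), D.incl_of_mem (y 0).2 hl.ne', add_zero, sub_self]

/-! ### From data to self-adjoint boundary conditions -/

namespace IsData

variable {D : DiracSystem H} {L F V : Submodule ℂ H} {g : ↥(V ⊔ L) →L[ℂ] ↥(V ⊔ L)}

theorem F_le (h : D.IsData L F V g) : F ≤ D.spec (Set.Iio 0) := by
  rw [← Hneg_eq_spec, ← h.sup_eq]
  exact le_sup_left

theorem V_le (h : D.IsData L F V g) : V ≤ D.spec (Set.Iio 0) := by
  rw [← Hneg_eq_spec, ← h.sup_eq]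
  exact le_sup_right

theorem L_le (h : D.IsData L F V g) : L ≤ D.spec {0} := by
  rw [← eig_zero_eq_spec]
  exact h.lagrangian.le

theorem sup_le (h : D.IsData L F V g) : V ⊔ L ≤ D.spec (Set.Iic 0) :=
  _root_.sup_le (h.V_le.trans (D.spec_mono Set.Iio_subset_Iic_self))
    (h.L_le.trans (D.spec_mono (fun _ hl => le_of_eq hl)))

theorem γ_sup (h : D.IsData L F V g) {w : H} (hw : w ∈ V ⊔ L) : D.γ w ∈ D.spec (Set.Ici 0) :=
  D.γ_mem_spec (fun _ hl => neg_nonneg.mpr hl) (h.sup_le hw)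

theorem γ_F (h : D.IsData L F V g) {f : H} (hf : f ∈ F) : D.γ f ∈ D.spec (Set.Ioi 0) :=
  D.γ_mem_spec (fun _ hl => neg_pos.mpr hl) (h.F_le hf)

/-- Negative and nonnegative spectral parts are orthogonal, as are the kernel and the positive part;
the only remaining term is on L, which is Lagrangian. -/
theorem inner_γ (h : D.IsData L F V g) {x y : H} (hx : x ∈ V ⊔ L) (hy : y ∈ V ⊔ L) :
    inner ℂ x (D.γ y) = 0 := by
  obtain ⟨v, hv, l, hl, rfl⟩ := Submodule.mem_sup.mp hx
  obtain ⟨v', hv', l', hl', rfl⟩ := Submodule.mem_sup.mp hy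
  have hd : Disjoint (Set.Iio (0 : ℝ)) (Set.Ici 0) := Set.Iio_disjoint_Ici le_rfl
  have hd' : Disjoint ({0} : Set ℝ) (Set.Ioi 0) := by simp
  have h1 : inner ℂ v (D.γ (v' + l')) = 0 :=
    D.inner_spec_of_disjoint hd (h.V_le hv) (h.γ_sup hy)
  have h2 : inner ℂ l (D.γ v') = 0 :=
    D.inner_spec_of_disjoint hd' (h.L_le hl)
      (D.γ_mem_spec (fun _ hl => neg_pos.mpr hl) (h.V_le hv'))
  rw [inner_add_left, h1, map_add, inner_add_right, h2, h.lagrangian.inner_γ hl hl', zero_add,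
    add_zero]

theorem inner_F (h : D.IsData L F V g) {f w : H} (hf : f ∈ F) (hw : w ∈ V ⊔ L) :
    inner ℂ f w = 0 := by
  obtain ⟨v, hv, l, hl, rfl⟩ := Submodule.mem_sup.mp hw
  rw [inner_add_right, Submodule.isOrtho_iff_inner_eq.mp h.ortho f hf v hv,
    D.inner_spec_of_disjoint (by simp) (h.F_le hf) (h.L_le hl), add_zero]

theorem inner_γ_F (h : D.IsData L F V g) {f w : H} (hf : f ∈ F) (hw : w ∈ D.spec (Set.Iic 0)) :
    inner ℂ w (D.γ f) = 0 :=
  D.inner_spec_of_disjoint (Set.Iic_disjoint_Ioi le_rfl) hw (h.γ_F hf)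

end IsData

theorem mem_graphPart (D : DiracSystem H) (W : Submodule ℂ H) (g : W →L[ℂ] W) (x : H) :
    x ∈ D.graphPart W g ↔ ∃ w : W, (w : H) ∈ D.Hhalf ∧ (w : H) + D.γ (g w) = x := Iff.rfl

theorem mem_sup_graphPart (D : DiracSystem H) (F W : Submodule ℂ H) (g : W →L[ℂ] W) (x : H) :
    x ∈ F.map D.γ.toLinearMap ⊔ D.graphPart W g ↔
      ∃ f ∈ F, ∃ w : W, (w : H) ∈ D.Hhalf ∧ D.γ f + ((w : H) + D.γ (g w)) = x := by
  rw [Submodule.mem_sup]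
  constructor
  · rintro ⟨_, ⟨f, hf, rfl⟩, _, ⟨w, hw, rfl⟩, rfl⟩
    exact ⟨f, hf, w, hw, rfl⟩
  · rintro ⟨f, hf, w, hw, rfl⟩
    exact ⟨_, Submodule.mem_map_of_mem hf, _, ⟨w, hw, rfl⟩, rfl⟩

namespace IsData

variable {D : DiracSystem H} {L F V : Submodule ℂ H} {g : ↥(V ⊔ L) →L[ℂ] ↥(V ⊔ L)}

theorem disjoint (h : D.IsData L F V g) :
    Disjoint (F.map D.γ.toLinearMap) (D.graphPart (V ⊔ L) g) := by
  rw [Submodule.disjoint_def]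
  rintro _ ⟨f, hf, rfl⟩ hx
  obtain ⟨w, -, hw⟩ := (D.mem_graphPart _ _ _).mp hx
  have hw' : (w : H) + D.γ (g w) = D.γ f := hw
  have h1 := h.inner_γ_F hf (h.sup_le w.2)
  rw [← hw', inner_add_right, h.inner_γ w.2 (g w).2, add_zero, inner_self_eq_zero] at h1
  have h2 : w = 0 := Subtype.ext h1
  rw [← hw, h2]
  simp

theorem le_Hhalf (h : D.IsData L F V g) :
    F.map D.γ.toLinearMap ⊔ D.graphPart (V ⊔ L) g ≤ D.Hhalf := by
  intro x hx
  obtain ⟨f, hf, w, hw, rfl⟩ := (D.mem_sup_graphPart _ _ _ _).mp hx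
  exact D.Hhalf.add_mem (D.γ_mem_Hhalf (h.smooth_F hf))
    (D.Hhalf.add_mem hw (D.γ_mem_Hhalf (h.smooth_g w hw)))

/-- All terms vanish by orthogonality except ⟨w', g w⟩ and -⟨g w', w⟩, which cancel because g is
symmetric. -/
theorem isotropic (h : D.IsData L F V g) {x y : H}
    (hx : x ∈ F.map D.γ.toLinearMap ⊔ D.graphPart (V ⊔ L) g)
    (hy : y ∈ F.map D.γ.toLinearMap ⊔ D.graphPart (V ⊔ L) g) : inner ℂ (D.γ y) x = 0 := by
  obtain ⟨f, hf, w, hw, rfl⟩ := (D.mem_sup_graphPart _ _ _ _).mp hx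
  obtain ⟨f', hf', w', hw', rfl⟩ := (D.mem_sup_graphPart _ _ _ _).mp hy
  have hFle : F ≤ D.spec (Set.Iic 0) := h.F_le.trans (D.spec_mono Set.Iio_subset_Iic_self)
  have hFγ (a : H) (ha : a ∈ F) (b : H) (hb : b ∈ V ⊔ L) : inner ℂ a (D.γ b) = 0 :=
    D.inner_spec_of_disjoint (Set.Iio_disjoint_Ici le_rfl) (h.F_le ha) (h.γ_sup hb)
  have hsym : inner ℂ (g w' : H) (w : H) = inner ℂ (w' : H) (g w : H) := h.symm w' w
  have hwf : inner ℂ (w' : H) f = 0 := by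
    rw [← inner_conj_symm, h.inner_F hf w'.2, map_zero]
  rw [map_add, map_add, D.γ_γ, D.γ_γ]
  simp only [inner_add_left, inner_add_right, inner_neg_left, D.inner_γ_γ]
  rw [h.inner_γ_F hf (hFle hf'), h.inner_F hf' w.2, hFγ f' hf' _ (g w).2, hwf,
    D.inner_γ_left, h.inner_γ w'.2 w.2, h.inner_γ_F hf (h.sup_le (g w').2), hsym,
    h.inner_γ (g w').2 (g w).2]
  ring

/-- Testing against γ F puts the negative part of y in V. Removing the matching graph element leaves
z' without negative part and with kernel part in γ L. Testing z' against V ⊕ L kills the kernel part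
and leaves only a functional on F, represented by an element of γ F. -/
theorem annihilator_le (h : D.IsData L F V g) {y : D.Formal}
    (hy : y ∈ D.annihilator ((F.map D.γ.toLinearMap ⊔ D.graphPart (V ⊔ L) g).map D.incl)) :
    y ∈ (F.map D.γ.toLinearMap ⊔ D.graphPart (V ⊔ L) g).map D.incl := by
  have := h.finite
  have hyt (x : H) (hx : x ∈ F.map D.γ.toLinearMap ⊔ D.graphPart (V ⊔ L) g) :
      D.ω (D.incl x) y = 0 :=
    hy.2 _ ⟨Submodule.mem_map_of_mem hx, D.Hhalf_check (h.le_Hhalf hx)⟩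
  obtain ⟨a, ⟨ha, haJ⟩, e, he, z, hz, hz0, rfl⟩ := D.exists_check_decomp hy.1
  have hae : a + e ∈ D.Hhalf := D.Hhalf.add_mem ha (D.eig_le_Hhalf 0 he)
  obtain ⟨l, hl, l', hl', rfl⟩ := h.lagrangian.exists_add he
  -- the negative part of `y` lies in `V`
  have haV : a ∈ V := by
    have haJ' := haJ
    have he0 : l + D.γ l' ∈ D.spec {0} := D.eig_zero_eq_spec ▸ he
    rw [SetLike.mem_coe, ← Hneg_eq_spec, ← h.sup_eq] at haJ'
    obtain ⟨f, hf, v, hv, rfl⟩ := Submodule.mem_sup.mp haJ'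
    have h1 := hyt (D.γ f) (Submodule.mem_sup_left (Submodule.mem_map_of_mem hf))
    have hγf : D.γ f ∈ D.Hhalf := D.γ_mem_Hhalf (h.smooth_F hf)
    rw [D.ω_add_right (D.Hhalf_check hγf) (D.Hhalf_check hae) hz, D.ω_incl hγf hae,
      D.ω_eq_zero_of_spec hγf (h.γ_F hf) hz (fun m hm => hz0 _ (by simpa using le_of_lt hm)),
      D.inner_γ_γ, add_zero, inner_add_left, inner_add_left,
      ← inner_conj_symm v f, Submodule.isOrtho_iff_inner_eq.mp h.ortho f hf v hv, map_zero,
      add_zero, ← inner_conj_symm (l + D.γ l') f, D.inner_spec_of_disjoint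
        (J := Set.Iio 0) (K := {0}) (by simp) (h.F_le hf) he0, map_zero, add_zero, inner_self_eq_zero] at h1
    rw [h1, zero_add]
    exact hv
  have hwW : a + l ∈ V ⊔ L := Submodule.add_mem_sup haV hl
  have hwH : a + l ∈ D.Hhalf := D.Hhalf.add_mem ha (D.eig_le_Hhalf 0 (h.lagrangian.le hl))
  let w : ↥(V ⊔ L) := ⟨a + l, hwW⟩
  have hgw : (g w : H) ∈ D.Hhalf := h.smooth_g w hwH
  have hBw : (w : H) + D.γ (g w) ∈ F.map D.γ.toLinearMap ⊔ D.graphPart (V ⊔ L) g :=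
    Submodule.mem_sup_right ⟨w, hwH, rfl⟩
  have hl'H : l' ∈ D.Hhalf := D.eig_le_Hhalf 0 (h.lagrangian.le hl')
  have huH : D.γ (l' - g w) ∈ D.Hhalf := D.γ_mem_Hhalf (D.Hhalf.sub_mem hl'H hgw)
  -- subtract the element of the boundary condition with the same negative part
  obtain ⟨z', hz', hyz, hz'neg, l'', hl'', hz'0⟩ : ∃ z' ∈ D.check,
      D.incl (a + (l + D.γ l')) + z = D.incl ((w : H) + D.γ (g w)) + z' ∧
      (∀ m < 0, z' m = 0) ∧ ∃ l'' ∈ L, (z' 0 : H) = D.γ l'' := by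
    refine ⟨D.incl (D.γ (l' - g w)) + z, D.check.add_mem (D.Hhalf_check huH) hz, ?_, ?_, ?_⟩
    · rw [← add_assoc (D.incl ((w : H) + D.γ (g w))), ← map_add D.incl]
      congr 2
      change a + (l + D.γ l') = (a + l) + D.γ (g w) + D.γ (l' - g w)
      rw [map_sub]
      abel
    · intro m hm
      rw [Pi.add_apply, hz0 m hm.le, add_zero]
      refine h.γ_sup (Submodule.sub_mem _ (Submodule.mem_sup_right hl') (g w).2) m ?_
      simpa using hm
    · obtain ⟨v₁, hv₁, l₁, hl₁, e₁⟩ := Submodule.mem_sup.mp (g w).2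
      refine ⟨l' - l₁, L.sub_mem hl' hl₁, ?_⟩
      rw [Pi.add_apply, hz0 0 le_rfl, add_zero, coe_incl_γ, neg_zero, ← e₁, ← sub_sub,
        sub_right_comm, map_sub D.incl, Pi.sub_apply, h.V_le hv₁ 0 (by simp), sub_zero,
        D.coe_incl_of_mem (h.lagrangian.le (L.sub_mem hl' hl₁))]
  rw [hyz] at hyt ⊢
  have hz't (x : H) (hx : x ∈ F.map D.γ.toLinearMap ⊔ D.graphPart (V ⊔ L) g) :
      D.ω (D.incl x) z' = 0 := by
    have h1 := hyt x hx
    have hxH := h.le_Hhalf hx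
    rwa [D.ω_add_right (D.Hhalf_check hxH) (D.Hhalf_check (h.le_Hhalf hBw)) hz',
      D.ω_incl hxH (h.le_Hhalf hBw), h.isotropic hx hBw, zero_add] at h1
  -- Test against w' + γ g w'. The second summand contributes nothing: z' has no negative part, and
  -- its kernel part lies in the isotropic space γ L.
  have hz'w (w' : H) (hw' : w' ∈ V ⊔ L) (hw'H : w' ∈ D.Hhalf) : D.ω (D.incl w') z' = 0 := by
    have h1 := hz't _ (Submodule.mem_sup_right ⟨⟨w', hw'⟩, hw'H, rfl⟩)
    have hgH : D.γ (g ⟨w', hw'⟩) ∈ D.Hhalf := D.γ_mem_Hhalf (h.smooth_g ⟨w', hw'⟩ hw'H)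
    change D.ω (D.incl (w' + D.γ (g ⟨w', hw'⟩))) z' = 0 at h1
    rw [map_add, D.ω_add_left (D.Hhalf_check hw'H) (D.Hhalf_check hgH) hz'] at h1
    obtain ⟨v₁, hv₁, l₁, hl₁, e₁⟩ := Submodule.mem_sup.mp (g ⟨w', hw'⟩).2
    have hl₁H : l₁ ∈ D.Hhalf := D.eig_le_Hhalf 0 (h.lagrangian.le hl₁)
    have hv₁H : v₁ ∈ D.Hhalf := by
      have := D.Hhalf.sub_mem (h.smooth_g ⟨w', hw'⟩ hw'H) hl₁H
      rwa [← e₁, add_sub_cancel_right] at this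
    have h2 : D.ω (D.incl (D.γ (g ⟨w', hw'⟩))) z' = 0 := by
      rw [← e₁, map_add, map_add, D.ω_add_left (D.Hhalf_check (D.γ_mem_Hhalf hv₁H))
        (D.Hhalf_check (D.γ_mem_Hhalf hl₁H)) hz',
        D.ω_eq_zero_of_spec (D.γ_mem_Hhalf hv₁H) (J := Set.Ioi 0)
          (D.γ_mem_spec (fun _ hl => neg_pos.mpr hl) (h.V_le hv₁)) hz'
          (fun m hm => hz'neg _ (by simpa using hm)),
        D.ω_eig (D.γ_mem_eig_zero (h.lagrangian.le hl₁)) hz', neg_zero, hz'0, D.inner_γ_γ,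
        D.inner_γ_left, h.lagrangian.inner_γ hl'' hl₁, neg_zero, add_zero]
    rwa [h2, add_zero] at h1
  have hl''0 : l'' = 0 := by
    have h1 := hz'w l'' (Submodule.mem_sup_right hl'') (D.eig_le_Hhalf 0 (h.lagrangian.le hl''))
    rw [D.ω_eig (h.lagrangian.le hl'') hz', neg_zero, hz'0, D.γ_γ, inner_neg_left, neg_eq_zero,
      inner_self_eq_zero] at h1
    exact h1
  -- the rest is `γ f` for some `f ∈ F`
  let φ : F →ₗ[ℂ] ℂ :=
    { toFun := fun x => D.ω (D.incl x) z'
      map_add' := fun x y => by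
        rw [Submodule.coe_add, map_add, D.ω_add_left (D.Hhalf_check (h.smooth_F x.2))
          (D.Hhalf_check (h.smooth_F y.2)) hz']
      map_smul' := fun c x => by
        rw [Submodule.coe_smul, map_smul, D.ω_smul_left c (D.Hhalf_check (h.smooth_F x.2)) hz']
        rfl }
  have : CompleteSpace F := FiniteDimensional.complete ℂ F
  let f : F := (InnerProductSpace.toDual ℂ F).symm (LinearMap.toContinuousLinearMap φ)
  have hf (x : F) : inner ℂ (f : H) (x : H) = D.ω (D.incl x) z' :=
    InnerProductSpace.toDual_symm_apply (𝕜 := ℂ) (E := F) (x := x)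
      (y := LinearMap.toContinuousLinearMap φ)
  have hfH : D.γ (f : H) ∈ D.Hhalf := D.γ_mem_Hhalf (h.smooth_F f.2)
  have hzf : z' + D.incl (D.γ f) ∈ D.check := D.check.add_mem hz' (D.Hhalf_check hfH)
  -- By the choice of f as Riesz representative, adding γ f cancels the functional on F. The sum
  -- then annihilates all of H^{1/2} with negative spectrum.
  have hkey (x : H) (hx : x ∈ D.spec (Set.Iio 0)) (hxH : x ∈ D.Hhalf) :
      D.ω (D.incl x) (z' + D.incl (D.γ f)) = 0 := by
    rw [D.ω_add_right (D.Hhalf_check hxH) hz' (D.Hhalf_check hfH), D.ω_incl hxH hfH, D.γ_γ,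
      inner_neg_left]
    rw [← Hneg_eq_spec, ← h.sup_eq] at hx
    obtain ⟨f', hf', v, hv, rfl⟩ := Submodule.mem_sup.mp hx
    have hvH : v ∈ D.Hhalf := by
      have := D.Hhalf.sub_mem hxH (h.smooth_F hf')
      rwa [add_sub_cancel_left] at this
    rw [map_add, D.ω_add_left (D.Hhalf_check (h.smooth_F hf')) (D.Hhalf_check hvH) hz',
      hz'w v (Submodule.mem_sup_left hv) hvH, ← hf ⟨f', hf'⟩, inner_add_right,
      Submodule.isOrtho_iff_inner_eq.mp h.ortho f f.2 v hv]
    ring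
  have hzero : z' + D.incl (D.γ f) = 0 := by
    funext m
    rcases lt_trichotomy m 0 with hm | rfl | hm
    · rw [Pi.add_apply, hz'neg m hm, h.γ_F f.2 m (by simpa using hm.le)]
      simp
    · refine Subtype.ext ?_
      rw [Pi.add_apply, h.γ_F f.2 0 (by simp), add_zero, hz'0, hl''0]
      simp
    -- Test against γ applied to the component at m, an eigenvector for -m: the result is the
    -- squared norm of that component.
    · have hx := D.γ_mem_eig_neg ((z' + D.incl (D.γ f)) m).2
      have h1 := hkey _ (D.eig_le_spec (by simpa using hm) hx) (D.eig_le_Hhalf _ hx)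
      rw [D.ω_eig hx hzf, neg_neg, inner_self_eq_zero, ← norm_eq_zero, D.norm_γ,
        norm_eq_zero] at h1
      exact Subtype.ext h1
  rw [eq_neg_of_add_eq_zero_left hzero]
  exact Submodule.add_mem _ (Submodule.mem_map_of_mem hBw) (Submodule.neg_mem _
    (Submodule.mem_map_of_mem (Submodule.mem_sup_left (Submodule.mem_map_of_mem f.2))))

/-- Closedness in Ȟ comes for free: once B equals its annihilator, it is closed because annihilators
are. -/
theorem isSelfAdjointBC (h : D.IsData L F V g) :
    D.IsSelfAdjointBC ((F.map D.γ.toLinearMap ⊔ D.graphPart (V ⊔ L) g).map D.incl) := by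
  have he : (F.map D.γ.toLinearMap ⊔ D.graphPart (V ⊔ L) g).map D.incl =
      D.annihilator ((F.map D.γ.toLinearMap ⊔ D.graphPart (V ⊔ L) g).map D.incl) := by
    refine le_antisymm ?_ (fun y hy => h.annihilator_le hy)
    rintro _ ⟨y, hy, rfl⟩
    refine ⟨D.Hhalf_check (h.le_Hhalf hy), ?_⟩
    rintro _ ⟨⟨x, hx, rfl⟩, -⟩
    rw [D.ω_incl (h.le_Hhalf hx) (h.le_Hhalf hy), h.isotropic hx hy]
  refine ⟨?_, he⟩
  rw [he]
  exact D.isBoundaryCondition_annihilator _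

theorem isRegular (h : D.IsData L F V g) :
    D.IsRegular ((F.map D.γ.toLinearMap ⊔ D.graphPart (V ⊔ L) g).map D.incl) := by
  refine ⟨h.isSelfAdjointBC.1, ?_⟩
  rintro _ ⟨y, hy, rfl⟩
  exact h.le_Hhalf hy

end IsData

/-- With F = 0 and g = 0 the boundary condition is H^{1/2}_< ⊕ L, of Atiyah–Patodi–Singer type. -/
theorem IsLagrangian.isData {D : DiracSystem H} {L : Submodule ℂ H} (hL : D.IsLagrangian L) :
    D.IsData L ⊥ D.Hneg 0 where
  lagrangian := hL
  finite := inferInstance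
  smooth_F := bot_le
  ortho := Submodule.isOrtho_bot_left
  sup_eq := bot_sup_eq _
  symm := fun x y => by simp
  smooth_g := fun w _ => by simp

/-! ### Estimates and closed projections for regular boundary conditions -/

/-- A closed subspace of `Ȟ` contained in `H^{1/2}` carries equivalent norms of `Ȟ` and
`H^{1/2}`. -/
theorem exists_half_bound (D : DiracSystem H) {B : Submodule ℂ D.Formal} (hB : D.IsRegular B) :
    ∃ C : ℝ, 0 ≤ C ∧ ∀ r, D.ofL2 r ∈ B →
      ∃ t, (∀ l, D.incl t l = weight (1 / 2) l • D.ofL2 r l) ∧ ‖t‖ ≤ C * ‖r‖ := by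
  have hcl := ((D.isBoundaryCondition_iff B).mp hB.1).2
  let N := B.comap D.ofL2
  have : CompleteSpace N := hcl.completeSpace_coe
  let T : N →ₗ[ℂ] H := D.iso.symm.toLinearEquiv.toLinearMap ∘ₗ D.sobolevIso (1 / 2) ∘ₗ
    D.ofL2.restrict (p := N) (q := D.sobolev (1 / 2)) (fun r hr => hB.2 hr)
  have hT (r : N) (l : ℝ) : D.incl (T r) l = weight (1 / 2) l • D.ofL2 r l :=
    congrFun (D.incl_iso_symm _) l
  have hc : Continuous T := by
    -- The graph is closed because convergence in either norm implies convergence of each component.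
    refine LinearMap.continuous_of_seq_closed_graph _ (fun u x y hu hTu => ?_)
    refine D.ext_incl (fun l => ?_)
    have h1 : Filter.Tendsto (fun n => D.incl (T (u n)) l) Filter.atTop (𝓝 (D.incl y l)) :=
      ((D.continuous_incl_apply l).tendsto y).comp hTu
    have hcont : Continuous (fun r : N => D.incl (T r) l) := by
      simp only [hT, ofL2_apply]
      have h0 : Continuous (fun r : N => D.incl (r : H) l) :=
        (D.continuous_incl_apply l).comp continuous_subtype_val
      have h1 := (h0.const_smul (checkWeight l)).const_smul (weight (1 / 2) l)
      exact h1
    exact tendsto_nhds_unique h1 ((hcont.tendsto x).comp hu)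
  let T' : N →L[ℂ] H := ⟨T, hc⟩
  exact ⟨‖T'‖, T'.opNorm_nonneg, fun r hr => ⟨T ⟨r, hr⟩, hT ⟨r, hr⟩, T'.le_opNorm ⟨r, hr⟩⟩⟩

theorem norm_weight_neg_one_le {R l : ℝ} (hR : 0 < R) (hl : R ≤ l) : ‖weight (-1) l‖ ≤ R⁻¹ := by
  have hl0 : 0 < l := hR.trans_le hl
  rw [weight, Complex.norm_real, Real.norm_of_nonneg (by positivity), neg_div,
    Real.rpow_neg (by positivity), ← Real.sqrt_eq_rpow]
  gcongr
  exact Real.le_sqrt_of_sq_le (by nlinarith)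

/-- At l > 0 the H^{1/2}-component t_l is (1 + l²)^{1/2} r_l. Hence the part of r above R has norm
at most ‖t‖ / R ≤ C ‖r‖ / R, which is absorbed once C / R ≤ 1/2; R = 2 C + 1 suffices. -/
theorem exists_cutoff (D : DiracSystem H) {B : Submodule ℂ D.Formal} (hB : D.IsRegular B) :
    ∃ R : ℝ, 0 < R ∧ ∀ r, D.ofL2 r ∈ B → ‖r‖ ≤ 2 * ‖D.proj (Set.Iic R) r‖ := by
  classical
  obtain ⟨C, hC, hbound⟩ := D.exists_half_bound hB
  have hR : 0 < 2 * C + 1 := by positivity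
  refine ⟨2 * C + 1, hR, fun r hr => ?_⟩
  set R := 2 * C + 1 with hRC
  obtain ⟨t, ht, htn⟩ := hbound r hr
  have hm (l : ℝ) : ‖(if R < l then weight (-1) l else 0 : ℂ)‖ ≤ R⁻¹ := by
    split_ifs with hl
    · exact norm_weight_neg_one_le hR hl.le
    · simpa using hR.le
  have he : r = D.proj (Set.Iic R) r + D.diag _ _ hm t := by
    refine D.ext_incl (fun l => ?_)
    rw [map_add, Pi.add_apply, incl_diag, ht]
    by_cases hl : R < l
    · rw [incl_proj_of_notMem D (by simpa using hl), if_pos hl, ofL2_apply,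
        checkWeight_of_pos (hR.trans hl), smul_smul, smul_smul, weight_mul, weight_mul]
      norm_num [weight_zero_left]
    · rw [incl_proj_of_mem D (by simpa using hl), if_neg hl, zero_smul, add_zero]
  have h1 : ‖r‖ ≤ ‖D.proj (Set.Iic R) r‖ + R⁻¹ * (C * ‖r‖) := by
    calc ‖r‖ = ‖D.proj (Set.Iic R) r + D.diag _ _ hm t‖ := by rw [← he]
      _ ≤ ‖D.proj (Set.Iic R) r‖ + ‖D.diag _ _ hm t‖ := norm_add_le _ _
      _ ≤ _ := by
        gcongr
        exact (D.norm_diag_le _ _ hm t).trans (by gcongr)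
  have h2 : R⁻¹ * C ≤ 1 / 2 := by
    rw [inv_mul_le_iff₀ hR, hRC]
    linarith
  nlinarith [norm_nonneg r]

theorem isClosed_map_proj_Iic (D : DiracSystem H) {B : Submodule ℂ D.Formal}
    (hB : D.IsRegular B) {R : ℝ}
    (hR : ∀ r, D.ofL2 r ∈ B → ‖r‖ ≤ 2 * ‖D.proj (Set.Iic R) r‖) :
    IsClosed ((B.comap D.ofL2).map (D.proj (Set.Iic R)).toLinearMap : Set H) := by
  have hcl := ((D.isBoundaryCondition_iff B).mp hB.1).2
  let N := B.comap D.ofL2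
  have : CompleteSpace N := hcl.completeSpace_coe
  let P : N →L[ℂ] H := (D.proj (Set.Iic R)) ∘L N.subtypeL
  have hP : AntilipschitzWith 2 P :=
    ContinuousLinearMap.antilipschitz_of_bound P (K := 2) (fun r => by
      rw [NNReal.coe_ofNat]
      exact hR r r.2)
  have := hP.isClosed_range P.uniformContinuous
  convert this using 1
  ext x
  constructor
  · rintro ⟨r, hr, rfl⟩
    exact ⟨⟨r, hr⟩, rfl⟩
  · rintro ⟨r, rfl⟩
    exact ⟨r, r.2, rfl⟩

/-- The projection for (-∞, R] is bounded below on B, so its image is closed. Passing to J changes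
it only by a finite-dimensional spectral subspace. The conditions on J allow both (-∞, 0) and (-∞,
0]. -/
theorem isClosed_map_proj (D : DiracSystem H) {B : Submodule ℂ D.Formal}
    (hB : D.IsRegular B) {J : Set ℝ} (hJ : J ⊆ Set.Iic 0) (hJ' : Set.Iio 0 ⊆ J) :
    IsClosed ((B.comap D.ofL2).map (D.proj J).toLinearMap : Set H) := by
  obtain ⟨R, hR0, hR⟩ := D.exists_cutoff hB
  have hcl := D.isClosed_map_proj_Iic hB hR
  have hfin : FiniteDimensional ℂ (D.spec (Set.Iic R \ J)) := by
    have := D.finiteDimensional_spec R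
    refine Submodule.finiteDimensional_of_le (D.spec_mono (K := Set.Icc (-R) R) (fun l hl => ?_))
    have : 0 ≤ l := not_lt.mp (fun h => hl.2 (hJ' h))
    exact ⟨by linarith, hl.1⟩
  have hunion : J ∪ (Set.Iic R \ J) = Set.Iic R :=
    Set.union_sdiff_cancel (hJ.trans (Set.Iic_subset_Iic.mpr hR0.le))
  have hsum (r : H) : D.proj (Set.Iic R) r = D.proj J r + D.proj (Set.Iic R \ J) r := by
    have := D.proj_union (J := J) (K := Set.Iic R \ J) Set.disjoint_sdiff_right r
    rwa [hunion] at this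
  have he : (B.comap D.ofL2).map (D.proj J).toLinearMap =
      ((B.comap D.ofL2).map (D.proj (Set.Iic R)).toLinearMap ⊔ D.spec (Set.Iic R \ J)) ⊓
        D.spec J := by
    refine le_antisymm ?_ ?_
    · rintro _ ⟨r, hr, rfl⟩
      refine ⟨?_, D.proj_mem_spec J r⟩
      have : D.proj J r = D.proj (Set.Iic R) r + -D.proj (Set.Iic R \ J) r := by
        rw [hsum]; abel
      change D.proj J r ∈ _
      rw [this]
      exact Submodule.add_mem_sup (Submodule.mem_map_of_mem hr)
        (Submodule.neg_mem _ (D.proj_mem_spec _ r))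
    · rintro x ⟨hx, hxJ⟩
      obtain ⟨_, ⟨r, hr, rfl⟩, e, he, rfl⟩ := Submodule.mem_sup.mp hx
      refine ⟨r, hr, ?_⟩
      rw [← D.proj_of_mem hxJ]
      change D.proj J r = D.proj J (D.proj (Set.Iic R) r + e)
      rw [hsum, map_add, map_add, D.proj_of_mem (D.proj_mem_spec J r),
        D.proj_of_disjoint Set.disjoint_sdiff_right (D.proj_mem_spec _ r),
        D.proj_of_disjoint Set.disjoint_sdiff_right he, add_zero, add_zero]
  rw [he]
  exact (Submodule.isClosed_sup_finiteDimensional _ _ hcl).inter (D.isClosed_spec J)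

theorem inner_proj (D : DiracSystem H) (J : Set ℝ) (x y : H) :
    inner ℂ (D.proj J x) y = inner ℂ x (D.proj J y) := by
  refine (D.hasSum_inner_incl _ y).unique ?_
  convert D.hasSum_inner_incl x (D.proj J y) using 2 with l
  by_cases hl : l ∈ J
  · rw [incl_proj_of_mem D hl, incl_proj_of_mem D hl]
  · rw [incl_proj_of_notMem D hl, incl_proj_of_notMem D hl, inner_zero_left, inner_zero_right]

theorem ofL2_of_spec (D : DiracSystem H) {J : Set ℝ} (hJ : J ⊆ Set.Iic 0) {p : H}
    (hp : p ∈ D.spec J) : D.ofL2 p = D.incl (D.halfEmb p) := by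
  funext l
  rw [ofL2_apply, incl_halfEmb]
  by_cases hl : l ∈ J
  · rw [checkWeight_of_nonpos (hJ hl)]
  · rw [hp l hl, smul_zero, smul_zero]

/-- For a regular self-adjoint boundary condition `B`, an element of `H^{1/2}_J` is the projection
of an element of `B` if it annihilates the elements of `B` supported on `-J`. -/
theorem exists_proj_eq (D : DiracSystem H) {B : Submodule ℂ D.Formal}
    (hB : D.IsRegular B) (hsa : D.IsSelfAdjointBC B) {J : Set ℝ} (hJ : J ⊆ Set.Iic 0)
    (hJ' : Set.Iio 0 ⊆ J) {x : H} (hx : x ∈ D.Hhalf) (hxJ : x ∈ D.spec J)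
    (h : ∀ y, D.incl y ∈ B → (∀ l, -l ∉ J → D.incl y l = 0) → inner ℂ (D.γ y) x = 0) :
    ∃ b, D.incl b ∈ B ∧ D.proj J b = x := by
  obtain ⟨p, rfl⟩ := D.exists_halfEmb hx
  have hp : p ∈ D.spec J := by
    intro l hl
    have h0 := hxJ l hl
    rw [incl_halfEmb] at h0
    exact (smul_eq_zero.mp h0).resolve_left (weight_ne_zero _ _)
  -- The image is closed, so it suffices that p is orthogonal to every q in its orthogonal
  -- complement.
  have hpS : p ∈ (B.comap D.ofL2).map (D.proj J).toLinearMap := by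
    have hcl := D.isClosed_map_proj hB hJ hJ'
    rw [← hcl.submodule_topologicalClosure_eq, ← Submodule.orthogonal_orthogonal_eq_closure,
      Submodule.mem_orthogonal]
    intro q hq
    -- Orthogonality of q to the projections of B says that γ Q_J q annihilates B; self-adjointness
    -- puts it in B, where the hypothesis on x can be used.
    have hs : D.ofL2 (D.γ (D.proj J q)) ∈ B := by
      rw [hsa.2, ofL2_mem_annihilator]
      intro r hr
      have h0 : inner ℂ (D.proj J r) q = 0 :=
        (Submodule.mem_orthogonal _ _).mp hq _ (Submodule.mem_map_of_mem hr)
      rw [D.γ_γ, inner_neg_left, inner_proj, neg_eq_zero, ← inner_conj_symm, h0, map_zero]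
    obtain ⟨y, hy, hys⟩ := D.exists_incl_of_sobolev (hB.2 hs)
    have h1 := h y (by rw [hys]; exact hs) (fun l hl => by
      rw [hys, ofL2_apply, (D.incl_γ_eq_zero_iff _ l).mpr (D.incl_proj_of_notMem hl q), smul_zero])
    rw [← D.ω_incl hx hy, hys, ← D.ofL2_of_spec hJ hp, ω_ofL2, D.γ_γ, inner_neg_left, inner_proj,
      D.proj_of_mem hp, neg_eq_zero] at h1
    exact h1
  obtain ⟨r, hr, rfl⟩ := hpS
  obtain ⟨b, -, hb⟩ := D.exists_incl_of_sobolev (hB.2 hr)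
  refine ⟨b, by rw [hb]; exact hr, D.ext_incl (fun l => ?_)⟩
  change _ = D.incl (D.halfEmb (D.proj J r)) l
  rw [incl_halfEmb]
  by_cases hl : l ∈ J
  · rw [incl_proj_of_mem D hl, incl_proj_of_mem D hl, hb, ofL2_apply,
      checkWeight_of_nonpos (hJ hl)]
  · rw [incl_proj_of_notMem D hl, incl_proj_of_notMem D hl, smul_zero]

/-! ### The finite-dimensional part F -/

/-- The elements `x` of `H_<` with `γ x ∈ B`. -/
def finitePart (D : DiracSystem H) (B : Submodule ℂ D.Formal) : Submodule ℂ H :=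
  D.Hneg ⊓ (B.comap D.incl).comap D.γ.toLinearMap

theorem mem_finitePart (D : DiracSystem H) (B : Submodule ℂ D.Formal) (x : H) :
    x ∈ D.finitePart B ↔ x ∈ D.spec (Set.Iio 0) ∧ D.incl (D.γ x) ∈ B := by
  rw [← Hneg_eq_spec]
  rfl

/-- By the cutoff estimate an element of B is determined by its part below R; for γ f, which has
positive spectrum, that part lies in a finite-dimensional space. -/
theorem finiteDimensional_finitePart (D : DiracSystem H) {B : Submodule ℂ D.Formal}
    (hB : D.IsRegular B) : FiniteDimensional ℂ (D.finitePart B) := by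
  obtain ⟨R, hR0, hR⟩ := D.exists_cutoff hB
  have := D.finiteDimensional_spec R
  have hpos {f : H} (hf : f ∈ D.finitePart B) : D.γ f ∈ D.spec (Set.Ioi 0) :=
    D.γ_mem_spec (fun _ hl => neg_pos.mpr hl) ((D.mem_finitePart B f).mp hf).1
  have hof {f : H} (hf : f ∈ D.finitePart B) :
      D.ofL2 (D.halfEmb (D.γ f)) = D.incl (D.γ f) := by
    funext l
    rw [ofL2_apply, incl_halfEmb]
    by_cases hl : 0 < l
    · rw [checkWeight_of_pos hl, smul_smul, weight_mul_neg, one_smul]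
    · rw [hpos hf l hl, smul_zero, smul_zero]
  let P : D.finitePart B →ₗ[ℂ] D.spec (Set.Icc (-R) R) :=
    LinearMap.codRestrict _ ((D.proj (Set.Iic R)).toLinearMap ∘ₗ D.halfEmb.toLinearMap ∘ₗ
      D.γ.toLinearMap ∘ₗ (D.finitePart B).subtype) (fun f l hl => by
        change D.incl (D.proj (Set.Iic R) (D.halfEmb (D.γ f))) l = 0
        by_cases hl' : l ∈ Set.Iic R
        · have : l ∉ Set.Ioi (0 : ℝ) := fun h0 => hl ⟨by linarith [Set.mem_Ioi.mp h0], hl'⟩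
          rw [incl_proj_of_mem D hl', incl_halfEmb, hpos f.2 l this, smul_zero]
        · rw [incl_proj_of_notMem D hl'])
  refine Module.Finite.of_injective P ?_
  rw [injective_iff_map_eq_zero]
  intro f hf
  have h0 : D.proj (Set.Iic R) (D.halfEmb (D.γ f)) = 0 := congrArg Subtype.val hf
  have h1 := hR (D.halfEmb (D.γ f)) (by
    rw [hof f.2]; exact ((D.mem_finitePart B f).mp f.2).2)
  rw [h0, norm_zero, mul_zero, norm_le_zero_iff] at h1
  have h2 : D.γ (f : H) = 0 := D.halfEmb_injective (h1.trans (map_zero _).symm)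
  rw [← norm_eq_zero, D.norm_γ, norm_eq_zero] at h2
  exact Subtype.ext h2

end DiracSystem
end

/-! ### Krein's lemma -/

noncomputable section

section Krein

variable {E K : Type*} [NormedAddCommGroup E] [NormedSpace ℂ E] [CompleteSpace E]
  [NormedAddCommGroup K] [InnerProductSpace ℂ K]

/-- The Hellinger–Toeplitz argument: symmetry passes to limits and shows that the graph of T is
closed. -/
theorem continuous_of_symmetric (ι : E →L[ℂ] K) (hι : Function.Injective ι) (T : E →ₗ[ℂ] E)
    (hT : ∀ x y, inner ℂ (ι (T x)) (ι y) = inner ℂ (ι x) (ι (T y))) : Continuous T := by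
  refine LinearMap.continuous_of_seq_closed_graph _ (fun u x y hu hTu => ?_)
  have h (z : E) : inner ℂ (ι y) (ι z) = inner ℂ (ι (T x)) (ι z) := by
    have h1 : Filter.Tendsto (fun n => inner ℂ (ι (T (u n))) (ι z)) Filter.atTop
        (𝓝 (inner ℂ (ι y) (ι z))) :=
      ((ι.continuous.tendsto y).comp hTu).inner tendsto_const_nhds
    have h2 : Filter.Tendsto (fun n => inner ℂ (ι (u n)) (ι (T z))) Filter.atTop
        (𝓝 (inner ℂ (ι x) (ι (T z)))) :=
      ((ι.continuous.tendsto x).comp hu).inner tendsto_const_nhds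
    simp only [hT] at h1 ⊢
    exact tendsto_nhds_unique h1 h2
  have h0 : inner ℂ (ι (y - T x)) (ι (y - T x)) = 0 := by
    conv_lhs => rw [map_sub ι, inner_sub_left, ← map_sub ι, h, sub_self]
  rw [inner_self_eq_zero] at h0
  exact sub_eq_zero.mp (hι (h0.trans (map_zero ι).symm))

/-- Krein's lemma: an operator on a Banach space which is symmetric for a continuous inner product
is bounded for the norm of this inner product. -/
theorem exists_bound_of_symmetric (ι : E →L[ℂ] K) (hι : Function.Injective ι) (T : E →ₗ[ℂ] E)
    (hT : ∀ x y, inner ℂ (ι (T x)) (ι y) = inner ℂ (ι x) (ι (T y))) :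
    ∃ C : ℝ, ∀ x, ‖ι (T x)‖ ≤ C * ‖ι x‖ := by
  let T' : E →L[ℂ] E := ⟨T, continuous_of_symmetric ι hι T hT⟩
  have hpow (n : ℕ) (x y : E) :
      inner ℂ (ι ((T ^ n) x)) (ι y) = inner ℂ (ι x) (ι ((T ^ n) y)) := by
    induction n generalizing x y with
    | zero => rfl
    | succ n ih => rw [pow_succ', Module.End.mul_apply, hT, ih, ← Module.End.mul_apply, ← pow_succ,
        ← pow_succ']
  -- Symmetry and Cauchy–Schwarz applied to ⟨x, T^{2n} x⟩.
  have hsq (n : ℕ) (x : E) : ‖ι ((T ^ n) x)‖ ^ 2 ≤ ‖ι x‖ * ‖ι ((T ^ (2 * n)) x)‖ := by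
    rw [@norm_sq_eq_re_inner ℂ, hpow, ← Module.End.mul_apply, ← pow_add, ← two_mul]
    exact re_inner_le_norm _ _
  set C := ‖T'‖ + 1 with hC
  have hC0 : 0 < C := by have := T'.opNorm_nonneg; positivity
  have hTn (n : ℕ) (x : E) : ‖(T ^ n) x‖ ≤ C ^ n * ‖x‖ := by
    induction n with
    | zero => simp
    | succ n ih =>
      rw [pow_succ', Module.End.mul_apply, pow_succ', mul_assoc]
      have h1 : ‖T ((T ^ n) x)‖ ≤ ‖T'‖ * ‖(T ^ n) x‖ := T'.le_opNorm _
      refine h1.trans ?_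
      gcongr
      linarith
  refine ⟨C, fun x => ?_⟩
  rcases eq_or_ne x 0 with rfl | hx
  · simp
  have ha : 0 < ‖ι x‖ := norm_pos_iff.mpr (fun h => hx (hι (h.trans (map_zero ι).symm)))
  -- Iterating the previous inequality along powers of two bounds the first iterate by a high one,
  -- for which the Banach norm gives geometric growth.
  have hind (n : ℕ) :
      ‖ι (T x)‖ ^ (2 ^ n) * ‖ι x‖ ≤ ‖ι x‖ ^ (2 ^ n) * ‖ι ((T ^ (2 ^ n)) x)‖ := by
    induction n with
    | zero => simp [mul_comm]
    | succ n ih =>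
      have h1 := pow_le_pow_left₀ (by positivity) ih 2
      rw [mul_pow, mul_pow, ← pow_mul, ← pow_mul] at h1
      have h2 := hsq (2 ^ n) x
      rw [← pow_succ'] at h2
      rw [← pow_succ] at h1
      refine le_of_mul_le_mul_right ?_ ha
      calc ‖ι (T x)‖ ^ 2 ^ (n + 1) * ‖ι x‖ * ‖ι x‖
          = ‖ι (T x)‖ ^ 2 ^ (n + 1) * ‖ι x‖ ^ 2 := by ring
        _ ≤ ‖ι x‖ ^ 2 ^ (n + 1) * ‖ι ((T ^ 2 ^ n) x)‖ ^ 2 := h1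
        _ ≤ ‖ι x‖ ^ 2 ^ (n + 1) * (‖ι x‖ * ‖ι ((T ^ 2 ^ (n + 1)) x)‖) := by gcongr
        _ = _ := by ring
  by_contra! hlt
  -- If the bound fails then ρ > 1, yet the powers ρ^(2^n) stay below the fixed number ‖ι‖ ‖x‖ / ‖ι
  -- x‖.
  set ρ := ‖ι (T x)‖ / (C * ‖ι x‖) with hρ
  have hρ1 : 1 < ρ := (one_lt_div (by positivity)).mpr hlt
  obtain ⟨n, hn⟩ := pow_unbounded_of_one_lt (‖ι‖ * ‖x‖ / ‖ι x‖) hρ1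
  have h1 : ρ ^ n ≤ ρ ^ (2 ^ n) := pow_le_pow_right₀ hρ1.le Nat.lt_two_pow_self.le
  have h2 : ‖ι ((T ^ (2 ^ n)) x)‖ ≤ ‖ι‖ * (C ^ (2 ^ n) * ‖x‖) :=
    (ι.le_opNorm _).trans (mul_le_mul_of_nonneg_left (hTn _ _) ι.opNorm_nonneg)
  have h3 : ρ ^ (2 ^ n) ≤ ‖ι‖ * ‖x‖ / ‖ι x‖ := by
    rw [hρ, div_pow, div_le_div_iff₀ (by positivity) ha, mul_pow]
    calc ‖ι (T x)‖ ^ 2 ^ n * ‖ι x‖ ≤ ‖ι x‖ ^ (2 ^ n) * ‖ι ((T ^ (2 ^ n)) x)‖ := hind n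
      _ ≤ ‖ι x‖ ^ (2 ^ n) * (‖ι‖ * (C ^ (2 ^ n) * ‖x‖)) := by gcongr
      _ = _ := by ring
  linarith

end Krein

namespace DiracSystem

variable {H : Type*} [NormedAddCommGroup H] [InnerProductSpace ℂ H] [CompleteSpace H]

/-! ### Normal form of a regular self-adjoint boundary condition -/

theorem annihilator_antitone (D : DiracSystem H) {B B' : Submodule ℂ D.Formal} (h : B ≤ B') :
    D.annihilator B' ≤ D.annihilator B :=
  fun _ hy => ⟨hy.1, fun x hx => hy.2 x ⟨h hx.1, hx.2⟩⟩

theorem proj_add_proj_add_proj (D : DiracSystem H) (x : H) :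
    D.proj (Set.Iio 0) x + D.proj {0} x + D.proj (Set.Ioi 0) x = x := by
  rw [← D.proj_union (by simp), ← D.proj_union (by simp)]
  refine D.proj_of_mem (fun l hl => absurd ?_ hl)
  rcases lt_trichotomy l 0 with h | h | h
  · exact Or.inl (Or.inl h)
  · exact Or.inl (Or.inr h)
  · exact Or.inr h

/-- The kernel parts of the elements of `B` without negative part. -/
def kernelPart (D : DiracSystem H) (B : Submodule ℂ D.Formal) : Submodule ℂ H :=
  (B.comap D.incl ⊓ D.spec (Set.Ici 0)).map (D.proj {0}).toLinearMap

theorem mem_kernelPart (D : DiracSystem H) (B : Submodule ℂ D.Formal) (x : H) :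
    x ∈ D.kernelPart B ↔ ∃ b, (D.incl b ∈ B ∧ b ∈ D.spec (Set.Ici 0)) ∧ D.proj {0} b = x :=
  Iff.rfl

/-- The complement of the finite part in `H_<`. -/
def graphDomain (D : DiracSystem H) (B : Submodule ℂ D.Formal) : Submodule ℂ H :=
  (D.finitePart B)ᗮ ⊓ D.Hneg

theorem kernelPart_le (D : DiracSystem H) (B : Submodule ℂ D.Formal) :
    D.kernelPart B ≤ D.eig 0 := by
  rintro _ ⟨b, -, rfl⟩
  rw [eig_zero_eq_spec]
  exact D.proj_mem_spec _ b

theorem spec_Ici_eq (D : DiracSystem H) {b : H} (hb : b ∈ D.spec (Set.Ici 0)) :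
    D.proj {0} b + D.proj (Set.Ioi 0) b = b := by
  have h := D.proj_add_proj_add_proj b
  rwa [D.proj_of_disjoint (Set.Iio_disjoint_Ici le_rfl) hb, zero_add] at h

namespace IsSelfAdjointBC

variable {D : DiracSystem H} {B : Submodule ℂ D.Formal}

theorem isotropic (hsa : D.IsSelfAdjointBC B) (hB : D.IsRegular B) {x y : H}
    (hx : D.incl x ∈ B) (hy : D.incl y ∈ B) : inner ℂ (D.γ y) x = 0 := by
  rw [← D.ω_incl (hB.2 hx) (hB.2 hy)]
  rw [hsa.2] at hy
  exact hy.2 _ ⟨hx, hB.1.1 hx⟩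

/-- For elements of B without negative part only the kernel parts pair under ω, so these are
isotropic. If k ∈ ker A is orthogonal to γ L, then `exists_proj_eq` with J = (-∞, 0] makes k the
nonpositive part of an element of B, so k ∈ L. Thus ker A = L + γ L. -/
theorem isLagrangian_kernelPart (hsa : D.IsSelfAdjointBC B) (hB : D.IsRegular B) :
    D.IsLagrangian (D.kernelPart B) := by
  have hle := D.kernelPart_le B
  have : FiniteDimensional ℂ (D.kernelPart B) := Submodule.finiteDimensional_of_le hle
  have hp (b : H) : D.proj {0} b ∈ D.spec {0} := D.proj_mem_spec _ b
  have hγp (b : H) : D.γ (D.proj {0} b) ∈ D.spec {0} :=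
    D.γ_mem_spec (fun l hl => by simpa using hl) (hp b)
  have hγq (b : H) : D.γ (D.proj (Set.Ioi 0) b) ∈ D.spec (Set.Iio 0) :=
    D.γ_mem_spec (fun l hl => by simpa using hl) (D.proj_mem_spec _ b)
  constructor
  · rw [Submodule.isOrtho_iff_inner_eq]
    rintro _ ⟨b, ⟨hb, hbs⟩, rfl⟩ _ ⟨_, ⟨b', ⟨hb', hbs'⟩, rfl⟩, rfl⟩
    change inner ℂ (D.proj {0} b) (D.γ (D.proj {0} b')) = 0
    have h := hsa.isotropic hB hb hb'
    have e := D.spec_Ici_eq hbs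
    rw [← D.spec_Ici_eq hbs', map_add, inner_add_left,
      D.inner_spec_of_disjoint (Set.Iio_disjoint_Ici le_rfl) (hγq b') hbs, add_zero, ← e,
      inner_add_right, D.inner_spec_of_disjoint (by simp) (hγp b') (D.proj_mem_spec (Set.Ioi 0) b),
      add_zero] at h
    rw [← inner_conj_symm, h, map_zero]
  · have hγle : (D.kernelPart B).map D.γ.toLinearMap ≤ D.eig 0 := by
      rintro _ ⟨x, hx, rfl⟩
      exact D.γ_mem_eig_zero (hle hx)
    refine le_antisymm (sup_le hle hγle) ?_
    rw [← Submodule.sup_orthogonal_inf_of_hasOrthogonalProjection hγle, sup_comm]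
    refine sup_le_sup_right ?_ _
    rintro k ⟨hk, hk0⟩
    have hks : k ∈ D.spec {0} := D.eig_zero_eq_spec ▸ hk0
    obtain ⟨b, hb, hbk⟩ := D.exists_proj_eq hB hsa (J := Set.Iic 0) subset_rfl
      Set.Iio_subset_Iic_self (x := k) (D.eig_le_Hhalf 0 hk0)
      (D.spec_mono (by simp) hks) (fun y hy hys => by
        have hyI : y ∈ D.spec (Set.Ici 0) := fun l hl => hys l (by simpa using hl)
        rw [← D.spec_Ici_eq hyI, map_add, inner_add_left,
          D.inner_spec_of_disjoint (by simp) (hγq y) hks, add_zero]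
        exact (Submodule.mem_orthogonal _ _).mp hk _
          (Submodule.mem_map_of_mem ⟨y, ⟨hy, hyI⟩, rfl⟩))
    refine ⟨b, ⟨hb, fun l hl => ?_⟩, ?_⟩
    · have hl' : l ∈ Set.Iic (0 : ℝ) := by simpa using le_of_lt (not_le.mp hl)
      rw [← D.incl_proj_of_mem hl', hbk]
      refine hks l ?_
      rintro rfl
      exact hl (Set.mem_Ici.mpr le_rfl)
    · change D.proj {0} b = k
      rw [← D.proj_of_mem hks, ← hbk]
      refine D.ext_incl (fun l => ?_)
      by_cases hl : l ∈ ({0} : Set ℝ)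
      · rw [D.incl_proj_of_mem hl, D.incl_proj_of_mem hl, D.incl_proj_of_mem (by
          rw [Set.mem_singleton_iff] at hl; exact hl.le)]
      · rw [D.incl_proj_of_notMem hl, D.incl_proj_of_notMem hl]

/-- The operator 0 is a placeholder: it makes the orthogonality results for L, F and V available
before g is constructed. -/
theorem isData_zero (hsa : D.IsSelfAdjointBC B) (hB : D.IsRegular B) :
    D.IsData (D.kernelPart B) (D.finitePart B) (D.graphDomain B) 0 where
  lagrangian := hsa.isLagrangian_kernelPart hB
  finite := D.finiteDimensional_finitePart hB
  smooth_F := fun f hf => by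
    have h := D.γ_mem_Hhalf (hB.2 ((D.mem_finitePart B f).mp hf).2)
    rw [D.γ_γ] at h
    exact (Submodule.neg_mem_iff _).mp h
  ortho := by
    rw [graphDomain]
    exact (Submodule.isOrtho_orthogonal_right _).mono_right inf_le_left
  sup_eq := by
    have := D.finiteDimensional_finitePart hB
    exact Submodule.sup_orthogonal_inf_of_hasOrthogonalProjection inf_le_left
  symm := fun x y => by simp
  smooth_g := fun w _ => by simp

/-- For y ∈ B with positive spectrum, γ y lies in F, so the solvability condition for J = (-∞, 0) is
orthogonality to F. -/
theorem exists_proj_eq_graphDomain (hsa : D.IsSelfAdjointBC B) (hB : D.IsRegular B) {v : H}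
    (hv : v ∈ D.graphDomain B) (hvH : v ∈ D.Hhalf) :
    ∃ b, D.incl b ∈ B ∧ D.proj (Set.Iio 0) b = v := by
  refine D.exists_proj_eq hB hsa Set.Iio_subset_Iic_self subset_rfl hvH
    (by rw [← Hneg_eq_spec]; exact hv.2) (fun y hy hys => ?_)
  refine (Submodule.mem_orthogonal _ _).mp hv.1 _ ?_
  rw [mem_finitePart]
  refine ⟨fun l hl => (D.incl_γ_eq_zero_iff y l).mpr (hys _ (by simpa using hl)), ?_⟩
  rw [D.γ_γ, map_neg]
  exact B.neg_mem hy

/-- Every element of `B` is, up to an element of `γ F`, in normal form. -/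
theorem exists_normalForm (hsa : D.IsSelfAdjointBC B) (hB : D.IsRegular B) {b l l' : H}
    (hb : D.incl b ∈ B) (hl' : l' ∈ D.kernelPart B)
    (he : D.proj {0} b = l + D.γ l') :
    ∃ z ∈ D.graphDomain B ⊔ D.kernelPart B, z ∈ D.Hhalf ∧
      D.incl (D.proj (Set.Iio 0) b + l + D.γ z) ∈ B := by
  have hd := hsa.isData_zero hB
  have hbH : b ∈ D.Hhalf := hB.2 hb
  -- The positive part of b is γ (f + v) with f ∈ F and v ∈ V; as γ f ∈ B, it can be subtracted.
  have hu : -D.γ (D.proj (Set.Ioi 0) b) ∈ D.finitePart B ⊔ D.graphDomain B := by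
    rw [hd.sup_eq, Hneg_eq_spec]
    exact Submodule.neg_mem _ (D.γ_mem_spec (fun l hl => by simpa using hl)
      (D.proj_mem_spec _ b))
  have huH : -D.γ (D.proj (Set.Ioi 0) b) ∈ D.Hhalf :=
    Submodule.neg_mem _ (D.γ_mem_Hhalf (D.proj_mem_Hhalf _ hbH))
  obtain ⟨f, hf, v, hv, hfv⟩ := Submodule.mem_sup.mp hu
  have hvH : v ∈ D.Hhalf := by
    rw [← hfv] at huH
    exact (Submodule.add_mem_iff_right _ (hd.smooth_F hf)).mp huH
  refine ⟨v + l', Submodule.add_mem_sup hv hl',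
    D.Hhalf.add_mem hvH (D.eig_le_Hhalf 0 (D.kernelPart_le B hl')), ?_⟩
  have e : D.proj (Set.Iio 0) b + l + D.γ (v + l') = b - D.γ f := by
    have h1 : D.proj (Set.Ioi 0) b = D.γ (f + v) := by
      rw [hfv, map_neg, D.γ_γ, neg_neg]
    conv_rhs => rw [← D.proj_add_proj_add_proj b, h1, he]
    rw [map_add, map_add]
    abel
  rw [e, map_sub]
  exact B.sub_mem hb ((D.mem_finitePart B f).mp hf).2

/-- Lift v to b ∈ B. The L-component of its kernel part may be wrong, but the error is the kernel
part of an element of B without negative part, which corrects it. -/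
theorem exists_graph (hsa : D.IsSelfAdjointBC B) (hB : D.IsRegular B) {w : H}
    (hw : w ∈ D.graphDomain B ⊔ D.kernelPart B) (hwH : w ∈ D.Hhalf) :
    ∃ z ∈ D.graphDomain B ⊔ D.kernelPart B, z ∈ D.Hhalf ∧ D.incl (w + D.γ z) ∈ B := by
  have hL := hsa.isLagrangian_kernelPart hB
  obtain ⟨v, hv, l, hl, rfl⟩ := Submodule.mem_sup.mp hw
  have hvH : v ∈ D.Hhalf :=
    (Submodule.add_mem_iff_left _ (D.eig_le_Hhalf 0 (D.kernelPart_le B hl))).mp hwH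
  obtain ⟨b, hb, hbv⟩ := hsa.exists_proj_eq_graphDomain hB hv hvH
  obtain ⟨l₁, hl₁, l₂, hl₂, e⟩ := hL.exists_add (D.eig_zero_eq_spec ▸ D.proj_mem_spec {0} b)
  obtain ⟨b', ⟨hb', hbs'⟩, e'⟩ := (D.mem_kernelPart B _).mp (Submodule.sub_mem _ hl hl₁)
  have h := hsa.exists_normalForm hB (b := b + b') (l := l) (l' := l₂)
    (by rw [map_add]; exact B.add_mem hb hb') hl₂ (by rw [map_add, ← e, e']; abel)
  rwa [map_add, hbv, D.proj_of_disjoint (Set.Iio_disjoint_Ici le_rfl) hbs', add_zero] at h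

/-- Uniqueness of the value of g. The kernel part of γ z lies in L ∩ γ L = 0, and what remains lies
in F ∩ V = 0. -/
theorem eq_zero_of_γ_mem (hsa : D.IsSelfAdjointBC B) (hB : D.IsRegular B) {z : H}
    (hz : z ∈ D.graphDomain B ⊔ D.kernelPart B) (hγz : D.incl (D.γ z) ∈ B) : z = 0 := by
  have hd := hsa.isData_zero hB
  have hL := hd.lagrangian
  obtain ⟨v, hv, l, hl, rfl⟩ := Submodule.mem_sup.mp hz
  have hγl : D.γ l ∈ D.kernelPart B := by
    refine (D.mem_kernelPart B _).mpr ⟨_, ⟨hγz, hd.γ_sup hz⟩, ?_⟩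
    rw [map_add, map_add, D.proj_of_disjoint (K := Set.Ioi 0) (by simp)
      (D.γ_mem_spec (fun _ hl => neg_pos.mpr hl) (hd.V_le hv)), zero_add, D.proj_of_mem]
    rw [← eig_zero_eq_spec]
    exact D.γ_mem_eig_zero (hL.le hl)
  have hl0 : l = 0 := by
    have h := hL.inner_γ hγl hl
    rwa [D.inner_γ_γ, inner_self_eq_zero] at h
  rw [hl0, add_zero] at hγz ⊢
  have hvF : v ∈ D.finitePart B := (D.mem_finitePart B v).mpr ⟨hd.V_le hv, hγz⟩
  exact inner_self_eq_zero.mp (Submodule.isOrtho_iff_inner_eq.mp hd.ortho v hvF v hv)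

theorem isClosed_graphDomain_sup (D : DiracSystem H) (B : Submodule ℂ D.Formal) :
    IsClosed ((D.graphDomain B ⊔ D.kernelPart B : Submodule ℂ H) : Set H) := by
  have : FiniteDimensional ℂ (D.kernelPart B) :=
    Submodule.finiteDimensional_of_le (D.kernelPart_le B)
  refine Submodule.isClosed_sup_finiteDimensional _ _ ?_
  exact (Submodule.isClosed_orthogonal _).inter (Submodule.isClosed_topologicalClosure _)

/-- Finite sums of negative eigenvectors are dense in H_<. Subtracting their projection to F keeps
them in H^{1/2}, since F ⊂ H^{1/2}, and moves them into V. -/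
theorem le_closure_inf_Hhalf (hsa : D.IsSelfAdjointBC B) (hB : D.IsRegular B) :
    D.graphDomain B ⊔ D.kernelPart B ≤
      ((D.graphDomain B ⊔ D.kernelPart B) ⊓ D.Hhalf).topologicalClosure := by
  have hd := hsa.isData_zero hB
  have := hd.finite
  refine sup_le (fun v hv => ?_) ?_
  · let P : H → H := fun x => x - (D.finitePart B).starProjection x
    have hP : Continuous P := by fun_prop
    have hPv : P v = v := by
      have : (D.finitePart B).starProjection v = 0 :=
        (Submodule.starProjection_apply_eq_zero_iff _).mpr hv.1
      simp [P, this]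
    rw [← hPv]
    have hv2 : v ∈ closure ((⨆ l ∈ Set.Iio (0 : ℝ), D.eig l : Submodule ℂ H) : Set H) := hv.2
    refine map_mem_closure hP hv2 ?_
    intro x hx
    have hxH : x ∈ D.Hhalf := (iSup₂_le fun l _ => D.eig_le_Hhalf l) hx
    have hpF : (D.finitePart B).starProjection x ∈ D.finitePart B :=
      Submodule.starProjection_apply_mem _ _
    refine ⟨Submodule.mem_sup_left ⟨?_, ?_⟩, ?_⟩
    · exact Submodule.sub_starProjection_mem_orthogonal x
    · exact Submodule.sub_mem _ (Submodule.le_topologicalClosure _ hx) hpF.1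
    · exact Submodule.sub_mem _ hxH (hd.smooth_F hpF)
  · intro l hl
    exact Submodule.le_topologicalClosure _
      ⟨Submodule.mem_sup_right hl, D.eig_le_Hhalf 0 (D.kernelPart_le B hl)⟩

theorem exists_isData (hsa : D.IsSelfAdjointBC B) (hB : D.IsRegular B) :
    ∃ (L F V : Submodule ℂ H) (g : ↥(V ⊔ L) →L[ℂ] ↥(V ⊔ L)), D.IsData L F V g ∧
      B = (F.map D.γ.toLinearMap ⊔ D.graphPart (V ⊔ L) g).map D.incl := by
  have hd := hsa.isData_zero hB
  set W := D.graphDomain B ⊔ D.kernelPart B with hW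
  have hWc : IsClosed (W : Set H) := isClosed_graphDomain_sup D B
  have : CompleteSpace W := hWc.completeSpace_coe
  -- E is (V ⊕ L) ∩ H^{1/2} with the norm of H^{1/2}: the Banach space in which Krein's lemma is
  -- applied, with ι its dense inclusion into V ⊕ L.
  let E : Submodule ℂ H := W.comap D.halfEmb.toLinearMap
  have hEc : IsClosed (E : Set H) := hWc.preimage D.halfEmb.continuous
  have : CompleteSpace E := hEc.completeSpace_coe
  let ι : E →L[ℂ] W := (D.halfEmb ∘L E.subtypeL).codRestrict W (fun x => x.2)
  have hιc (x : E) : (ι x : H) = D.halfEmb x := rfl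
  have hι : Function.Injective ι := fun x y h =>
    Subtype.ext (D.halfEmb_injective (by rw [← hιc, ← hιc, h]))
  have hιH (x : E) : (ι x : H) ∈ D.Hhalf := D.halfEmb_mem x
  have hιs (w : W) (hw : (w : H) ∈ D.Hhalf) : ∃ x, ι x = w := by
    obtain ⟨p, hp⟩ := D.exists_halfEmb hw
    refine ⟨⟨p, ?_⟩, Subtype.ext hp⟩
    change D.halfEmb p ∈ W
    rw [hp]
    exact w.2
  have hdense : DenseRange ι := by
    rw [DenseRange, Subtype.dense_iff]
    intro w hw
    refine closure_mono ?_ (hsa.le_closure_inf_Hhalf hB hw)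
    rintro x ⟨hx, hxH⟩
    obtain ⟨e, he⟩ := hιs ⟨x, hx⟩ hxH
    exact ⟨⟨x, hx⟩, ⟨e, he⟩, rfl⟩
  have hex (x : E) : ∃ y : E, D.incl ((ι x : H) + D.γ (ι y)) ∈ B := by
    obtain ⟨z, hz, hzH, hzB⟩ := hsa.exists_graph hB (ι x).2 (hιH x)
    obtain ⟨y, hy⟩ := hιs ⟨z, hz⟩ hzH
    exact ⟨y, by rw [hy]; exact hzB⟩
  choose T₀ hT₀ using hex
  have huniq (x y : E) (h : D.incl ((ι x : H) + D.γ (ι y)) ∈ B) : T₀ x = y := by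
    have h1 := B.sub_mem (hT₀ x) h
    rw [← map_sub, add_sub_add_left_eq_sub, ← map_sub, ← Submodule.coe_sub, ← map_sub] at h1
    have h2 := hsa.eq_zero_of_γ_mem hB (ι (T₀ x - y)).2 h1
    have h3 : ι (T₀ x - y) = 0 := Subtype.ext h2
    exact sub_eq_zero.mp (hι (h3.trans (map_zero ι).symm))
  let T : E →ₗ[ℂ] E :=
    { toFun := T₀
      map_add' := fun x y => huniq _ _ (by
        have h := B.add_mem (hT₀ x) (hT₀ y)
        rw [← map_add, add_add_add_comm, ← map_add, ← Submodule.coe_add, ← Submodule.coe_add,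
          ← map_add, ← map_add] at h
        exact h)
      map_smul' := fun c x => huniq _ _ (by
        have h := B.smul_mem c (hT₀ x)
        rw [← map_smul, smul_add, ← map_smul, ← Submodule.coe_smul, ← Submodule.coe_smul,
          ← map_smul, ← map_smul] at h
        exact h) }
  -- Isotropy of B, applied to two graph elements, is exactly the symmetry of T for the inner
  -- product of H.
  have hT (x y : E) : inner ℂ (ι (T x)) (ι y) = inner ℂ (ι x) (ι (T y)) := by
    have h := hsa.isotropic hB (hT₀ y) (hT₀ x)
    rw [map_add, D.γ_γ] at h
    simp only [inner_add_left, inner_add_right, inner_neg_left, D.inner_γ_γ] at h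
    rw [D.inner_γ_left, hd.inner_γ (ι x).2 (ι y).2, hd.inner_γ (ι (T₀ x)).2 (ι (T₀ y)).2] at h
    change inner ℂ (ι (T₀ x) : H) (ι y : H) = inner ℂ (ι x : H) (ι (T₀ y) : H)
    linear_combination -h
  let f : E →ₗ[ℂ] W := ι.toLinearMap ∘ₗ T
  obtain ⟨C, hC⟩ := exists_bound_of_symmetric ι hι T hT
  let g : W →L[ℂ] W := f.extendOfNorm ι.toLinearMap
  have hg (x : E) : g (ι x) = ι (T x) :=
    LinearMap.extendOfNorm_eq (f := f) (e := ι.toLinearMap) hdense ⟨C, hC⟩ x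
  have hdata : D.IsData (D.kernelPart B) (D.finitePart B) (D.graphDomain B) g :=
    { lagrangian := hd.lagrangian
      finite := hd.finite
      smooth_F := hd.smooth_F
      ortho := hd.ortho
      sup_eq := hd.sup_eq
      symm := by
        intro x y
        refine DenseRange.induction_on₂ (p := fun x y : W => inner ℂ (g x) y = inner ℂ x (g y))
          hdense (isClosed_eq (by fun_prop) (by fun_prop)) (fun a b => ?_) x y
        rw [hg, hg]
        exact hT a b
      smooth_g := fun w hw => by
        obtain ⟨x, rfl⟩ := hιs w hw
        rw [hg]
        exact hιH _ }
  refine ⟨_, _, _, g, hdata, ?_⟩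
  have hle : (D.finitePart B).map D.γ.toLinearMap ⊔ D.graphPart W g ≤ B.comap D.incl := by
    intro x hx
    obtain ⟨a, ha, w, hw, rfl⟩ := (D.mem_sup_graphPart _ _ _ _).mp hx
    obtain ⟨e, rfl⟩ := hιs w hw
    rw [hg, Submodule.mem_comap, map_add]
    exact B.add_mem ((D.mem_finitePart B a).mp ha).2 (hT₀ e)
  have hle' := Submodule.map_le_iff_le_comap.mpr hle
  refine le_antisymm ?_ hle'
  -- Maximality: both spaces equal their annihilators, and taking annihilators reverses the
  -- inclusion already known.
  rw [hdata.isSelfAdjointBC.2]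
  conv_lhs => rw [hsa.2]
  exact D.annihilator_antitone hle'

end IsSelfAdjointBC

end DiracSystem
end

/-! ### Assembly of the theorem -/

theorem mainTheorem7 {H : Type*} [NormedAddCommGroup H] [InnerProductSpace ℂ H]
    [CompleteSpace H] [TopologicalSpace.SeparableSpace H] (D : DiracSystem H) :
    -- existence of regular self-adjoint boundary conditions
    ((∃ B : Submodule ℂ D.Formal, D.IsRegular B ∧ D.IsSelfAdjointBC B) ↔
      D.IsHermitianSymplectic) ∧
    -- reformulation by the index
    UnboundedFredholm D.Aplus ∧
    (D.IsHermitianSymplectic ↔ unboundedIndex D.Aplus = 0) ∧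
    ((∃ B : Submodule ℂ D.Formal, D.IsElliptic B ∧ D.IsSelfAdjointBC B) ↔
      unboundedIndex D.Aplus = 0) ∧
    -- all data give regular self-adjoint boundary conditions
    (∀ (L F V : Submodule ℂ H) (g : ↥(V ⊔ L) →L[ℂ] ↥(V ⊔ L)), D.IsData L F V g →
      Disjoint (F.map D.γ.toLinearMap) (D.graphPart (V ⊔ L) g) ∧
      D.IsRegular ((F.map D.γ.toLinearMap ⊔ D.graphPart (V ⊔ L) g).map D.incl) ∧
      D.IsSelfAdjointBC ((F.map D.γ.toLinearMap ⊔ D.graphPart (V ⊔ L) g).map D.incl)) ∧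
    -- and there are no others
    (∀ B : Submodule ℂ D.Formal, D.IsRegular B → D.IsSelfAdjointBC B →
      ∃ (L F V : Submodule ℂ H) (g : ↥(V ⊔ L) →L[ℂ] ↥(V ⊔ L)), D.IsData L F V g ∧
        B = (F.map D.γ.toLinearMap ⊔ D.graphPart (V ⊔ L) g).map D.incl) := by
  have h1 : (∃ B : Submodule ℂ D.Formal, D.IsRegular B ∧ D.IsSelfAdjointBC B) ↔
      D.IsHermitianSymplectic := by
    constructor
    · rintro ⟨B, hB, hsa⟩
      exact (hsa.isLagrangian_kernelPart hB).isHermitianSymplectic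
    · intro h
      obtain ⟨L, hL⟩ := h.exists_isLagrangian
      exact ⟨_, hL.isData.isRegular, hL.isData.isSelfAdjointBC⟩
  refine ⟨h1, D.fredholm_Aplus, D.isHermitianSymplectic_iff_index, ?_,
    fun L F V g h => ⟨h.disjoint, h.isRegular, h.isSelfAdjointBC⟩,
    fun B hB hsa => hsa.exists_isData hB⟩
  rw [← DiracSystem.isHermitianSymplectic_iff_index, ← h1]
  -- For B = B^a the second regularity condition repeats the first, so elliptic and regular
  -- coincide.
  refine exists_congr (fun B => and_congr_left (fun hsa => ⟨fun h => h.1, fun h => ⟨h, ?_⟩⟩))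
  rwa [← hsa.2]
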